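/- **Setting.** Let $n\in\{1,2,3\}$, let $\Omega\subset\mathbb R^n$ be open, bounded and connected, and let $Y=(0,1)^n$ contain two disjoint open sets $Y_l,Y_s$ with $\overline{Y_l}\cup\overline{Y_s}=\overline Y$ and $\overline{Y_s}\subset Y$. For $0<\varepsilon<1$ let $K_\varepsilon=\{k\in\mathbb Z^n:\varepsilon(k+Y)\subset\Omega\}$ and assume $\overline\Omega=\bigcup_{k\in K_\varepsilon}\varepsilon(k+\overline Y)$. The pore space is $\Omega_\varepsilon=\Omega\cap\operatorname{int}\bigcup_{k\in K_\varepsilon}\varepsilon(k+\overline{Y_l})$, and its inner boundary is $\Gamma_\varepsilon=\bigcup_{k\in K_\varepsilon}\varepsilon(k+\overline{Y_l}\cap\overline{Y_s})$. Assume that $\Omega_\varepsilon$ is connected and has $C^{0,1}$ boundary. Let $\Gamma_{\varepsilon,D}\subset\Gamma_\varepsilon$ be measurable and $\Gamma_{\varepsilon,N}=\Gamma_\varepsilon\setminus\Gamma_{\varepsilon,D}$. Let $\alpha,\beta,\gamma,\sigma,\Phi_D\in\mathbb R$ and $T>0$ be constants, and let $c^{\pm,0}:\Omega\to\mathbb R$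 be measurable with $0\le c^{\pm,0}(x)\le\Lambda$ for all $x\in\Omega$, where $\Lambda$ does not depend on $\varepsilon$. A weak solution of Problem $\tilde P_\varepsilon$ is a tuple $(v,p,\Phi,c^+,c^-)$ with $v\in L^\infty(0,T;H^1_0(\Omega_\varepsilon)^n)$, $p\in L^\infty(0,T;L^2(\Omega_\varepsilon))$, $\Phi\in L^\infty(0,T;H^1(\Omega_\varepsilon))$, $c^\pm\in L^\infty(0,T;L^2(\Omega_\varepsilon))\cap L^2(0,T;H^1(\Omega_\varepsilon))$, $\partial_tc^\pm\in L^2(0,T;(H^1(\Omega_\varepsilon))')$, $c^\pm(0)=c^{\pm,0}$ on $\Omega_\varepsilon$, and $\Phi=\Phi_D$ on $\Gamma_{\varepsilon,D}$ in the sense of traces, such that for almost every $t\in(0,T)$ (the integrals on the right of the first equation and in the flux term of the last one being required to exist) $$\int_{\Omega_\varepsilon}\varepsilon^2\nabla v:\nabla\varphi_1-p\,\nabla\cdot\varphi_1\,dx=-\int_{\Omega_\varepsilon}\varepsilon^\beta(c^+-c^-)\nabla\Phi\cdot\varphi_1\,dx,\qquad \int_{\Omega_\varepsilon}v\cdot\nabla\psi\,dx=0,$$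 $$\int_{\Omega_\varepsilon}\varepsilon^\alpha\nabla\Phi\cdot\nabla\varphi_2\,dx-\int_{\Gamma_{\varepsilon,N}}\varepsilon\sigma\varphi_2\,do=\int_{\Omega_\varepsilon}(c^+-c^-)\varphi_2\,dx,$$ $$\langle\partial_tc^\pm,\varphi_3\rangle+\int_{\Omega_\varepsilon}\bigl(-vc^\pm+\nabla c^\pm\pm\varepsilon^\gamma\max(0,c^\pm)\nabla\Phi\bigr)\cdot\nabla\varphi_3\,dx=\mp\int_{\Omega_\varepsilon}(c^+-c^-)\varphi_3\,dx$$ for all $\varphi_1\in H^1_0(\Omega_\varepsilon)^n$, all $\psi,\varphi_3\in H^1(\Omega_\varepsilon)$, and all $\varphi_2\in H^1(\Omega_\varepsilon)$ with zero trace on $\Gamma_{\varepsilon,D}$. **Theorem.** For every such $\varepsilon$ and every weak solution $(v,p,\Phi,c^+,c^-)$ of Problem $\tilde P_\varepsilon$ the concentrations are bounded from above uniformly in $\varepsilon$, in each of the following two cases. 1. If the volume additivity constraint $c^++c^-=1$ holds almost everywhere in $(0,T)\times\Omega_\varepsilon$ (with any of the above boundary conditions for $\Phi$), then $c^\pm\le\Lambda$,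 and also $c^\pm\le1$, almost everywhere in $(0,T)\times\Omega_\varepsilon$. 2. If the potential satisfies homogeneous Neumann conditions, i.e. $\Gamma_{\varepsilon,D}=\emptyset$ and $\sigma=0$, then $c^\pm\le\Lambda$ almost everywhere in $(0,T)\times\Omega_\varepsilon$, without the volume additivity constraint. -/

import Mathlib

open MeasureTheory Set Filter Topology
open scoped ContDiff RealInnerProductSpace

noncomputable section

namespace SNPP

/-! ## Geometry: the periodically perforated domain -/

/-- The physical space `ℝⁿ` with its Euclidean norm. -/
abbrev E (n : ℕ) := EuclideanSpace ℝ (Fin n)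

/-- The open unit cell `Y = (0,1)ⁿ`. -/
def unitCell (n : ℕ) : Set (E n) := {y | ∀ i, 0 < y i ∧ y i < 1}

/-- The unit cell consists of a liquid part `Yl` and a solid part `Ys`: disjoint open sets whose
closures fill the closed cell, the solid part not touching the boundary of the cell. -/
structure IsCellDecomposition {n : ℕ} (Yl Ys : Set (E n)) : Prop where
  isOpen_liquid : IsOpen Yl
  isOpen_solid : IsOpen Ys
  disjoint : Disjoint Yl Ys
  closure_union : closure Yl ∪ closure Ys = closure (unitCell n)
  solid_inside : closure Ys ⊆ unitCell n

/-- The scaled and shifted copy `ε (k + S)` of a subset `S` of the (closed) unit cell. -/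
def cellCopy {n : ℕ} (ε : ℝ) (k : Fin n → ℤ) (S : Set (E n)) : Set (E n) :=
  (fun y : E n => ε • (WithLp.toLp 2 (fun i => (k i : ℝ)) + y)) '' S

/-- The indices of those cells of the `ε`-mesh that lie in `Ω`. -/
def cellIndices {n : ℕ} (Ω : Set (E n)) (ε : ℝ) : Set (Fin n → ℤ) :=
  {k | cellCopy ε k (unitCell n) ⊆ Ω}

/-- `Ω` is completely covered by `ε`-scaled cells. -/
def IsCoveredByCells {n : ℕ} (Ω : Set (E n)) (ε : ℝ) : Prop :=
  closure Ω = ⋃ k ∈ cellIndices Ω ε, cellCopy ε k (closure (unitCell n))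

/-- The pore space `Ω_ε`: the union of the liquid parts of all cells (together with the
interfaces between neighbouring cells, which the union of the open parts would miss). -/
def poreSpace {n : ℕ} (Ω Yl : Set (E n)) (ε : ℝ) : Set (E n) :=
  Ω ∩ interior (⋃ k ∈ cellIndices Ω ε, cellCopy ε k (closure Yl))

/-- The inner boundary `Γ_ε`: the union of the scaled copies of `Γ`, the intersection of the
closures of the liquid and the solid part. -/
def innerBoundary {n : ℕ} (Ω Yl Ys : Set (E n)) (ε : ℝ) : Set (E n) :=
  ⋃ k ∈ cellIndices Ω ε, cellCopy ε k (closure Yl ∩ closure Ys)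

/-- `C^{0,1}` boundary: near each boundary point the set is, in some direction `d`, the part
of space strictly above the graph of a Lipschitz function on the hyperplane `d^⊥`. -/
def HasLipschitzBoundary {n : ℕ} (U : Set (E n)) : Prop :=
  ∀ x ∈ frontier U, ∃ (d : E n) (ψ : E n → ℝ) (L : NNReal) (r : ℝ),
    ‖d‖ = 1 ∧ LipschitzWith L ψ ∧ 0 < r ∧
      ∀ y ∈ Metric.ball x r, (y ∈ U ↔ ψ (y - ⟪d, y⟫ • d) < ⟪d, y⟫)

/-- The `(n-1)`-dimensional surface measure. -/
def surfaceMeasure (n : ℕ) : Measure (E n) := Measure.euclideanHausdorffMeasure (n - 1)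

/-! ## Sobolev spaces -/

/-- `φ ∈ C_c^∞(U)`. -/
structure IsTestFunction {n : ℕ} (U : Set (E n)) (φ : E n → ℝ) : Prop where
  smooth : ContDiff ℝ ∞ φ
  compact : HasCompactSupport φ
  support : tsupport φ ⊆ U

/-- `L²(U)`. -/
abbrev L2 {n : ℕ} (U : Set (E n)) := Lp ℝ 2 (volume.restrict U)

/-- `L²(U; ℝⁿ)`. -/
abbrev L2Vec {n : ℕ} (U : Set (E n)) := Lp (E n) 2 (volume.restrict U)

/-- `G` is the weak gradient of `u` in `U`. -/
def IsWeakGradient {n : ℕ} (U : Set (E n)) (u : E n → ℝ) (G : E n → E n) : Prop :=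
  ∀ φ : E n → ℝ, IsTestFunction U φ →
    ∫ x in U, u x • gradient φ x = - ∫ x in U, φ x • G x

theorem IsTestFunction.continuous_gradient {n : ℕ} {U : Set (E n)} {φ : E n → ℝ}
    (h : IsTestFunction U φ) : Continuous (gradient φ) := by
  unfold gradient
  exact (InnerProductSpace.toDual ℝ (E n)).symm.continuous.comp
    (h.smooth.continuous_fderiv (by simp))

theorem IsTestFunction.compact_gradient {n : ℕ} {U : Set (E n)} {φ : E n → ℝ}
    (h : IsTestFunction U φ) : HasCompactSupport (gradient φ) := by
  refine (h.compact.fderiv (𝕜 := ℝ)).mono ?_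
  intro x hx hx'
  apply hx
  simp [gradient, hx']

theorem IsTestFunction.integrable_smul_gradient {n : ℕ} {U : Set (E n)} {φ : E n → ℝ}
    (h : IsTestFunction U φ) (u : L2 U) :
    Integrable (fun x => u x • gradient φ x) (volume.restrict U) := by
  have h1 : MemLp (gradient φ) 2 (volume.restrict U) :=
    h.continuous_gradient.memLp_of_hasCompactSupport h.compact_gradient
  exact memLp_one_iff_integrable.1 (h1.smul (Lp.memLp u))

theorem IsTestFunction.integrable_smul_vec {n : ℕ} {U : Set (E n)} {φ : E n → ℝ}
    (h : IsTestFunction U φ) (G : L2Vec U) :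
    Integrable (fun x => φ x • G x) (volume.restrict U) := by
  have h1 : MemLp φ 2 (volume.restrict U) :=
    h.smooth.continuous.memLp_of_hasCompactSupport h.compact
  exact memLp_one_iff_integrable.1 ((Lp.memLp G).smul h1)

/-- The Sobolev space `H¹(U)` as the subspace of pairs of a function in `L²(U)` and its weak
gradient in `L²(U; ℝⁿ)`, with the norm `(‖u‖² + ‖∇u‖²)^{1/2}`. -/
def h1Subspace {n : ℕ} (U : Set (E n)) : Submodule ℝ (WithLp 2 (L2 U × L2Vec U)) where
  carrier := {z | IsWeakGradient U z.fst z.snd}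
  zero_mem' := by
    intro φ hφ
    have h1 : ∫ x in U, ((0 : L2 U) : E n → ℝ) x • gradient φ x = 0 := by
      refine integral_eq_zero_of_ae ?_
      filter_upwards [Lp.coeFn_zero ℝ 2 (volume.restrict U)] with x hx
      rw [hx, Pi.zero_apply, zero_smul, Pi.zero_apply]
    have h2 : ∫ x in U, φ x • ((0 : L2Vec U) : E n → E n) x = 0 := by
      refine integral_eq_zero_of_ae ?_
      filter_upwards [Lp.coeFn_zero (E n) 2 (volume.restrict U)] with x hx
      rw [hx]
      exact smul_zero _
    change ∫ x in U, ((0 : L2 U) : E n → ℝ) x • gradient φ x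
      = - ∫ x in U, φ x • ((0 : L2Vec U) : E n → E n) x
    rw [h1, h2, neg_zero]
  add_mem' := by
    intro a b ha hb φ hφ
    have e1 : ∫ x in U, ((a.fst + b.fst : L2 U) : E n → ℝ) x • gradient φ x
        = (∫ x in U, a.fst x • gradient φ x) + ∫ x in U, b.fst x • gradient φ x := by
      rw [← integral_add (hφ.integrable_smul_gradient _) (hφ.integrable_smul_gradient _)]
      refine integral_congr_ae ?_
      filter_upwards [Lp.coeFn_add a.fst b.fst] with x hx
      rw [hx, Pi.add_apply, add_smul]
    have e2 : ∫ x in U, φ x • ((a.snd + b.snd : L2Vec U) : E n → E n) x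
        = (∫ x in U, φ x • a.snd x) + ∫ x in U, φ x • b.snd x := by
      rw [← integral_add (hφ.integrable_smul_vec _) (hφ.integrable_smul_vec _)]
      refine integral_congr_ae ?_
      filter_upwards [Lp.coeFn_add a.snd b.snd] with x hx
      rw [hx, Pi.add_apply, smul_add]
    change ∫ x in U, ((a.fst + b.fst : L2 U) : E n → ℝ) x • gradient φ x
      = - ∫ x in U, φ x • ((a.snd + b.snd : L2Vec U) : E n → E n) x
    rw [e1, e2, ha φ hφ, hb φ hφ, neg_add]
  smul_mem' := by
    intro r a ha φ hφ
    have e1 : ∫ x in U, ((r • a.fst : L2 U) : E n → ℝ) x • gradient φ x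
        = r • ∫ x in U, a.fst x • gradient φ x := by
      rw [← integral_smul]
      refine integral_congr_ae ?_
      filter_upwards [Lp.coeFn_smul r a.fst] with x hx
      rw [hx, Pi.smul_apply, smul_assoc]
    have e2 : ∫ x in U, φ x • ((r • a.snd : L2Vec U) : E n → E n) x
        = r • ∫ x in U, φ x • a.snd x := by
      rw [← integral_smul]
      refine integral_congr_ae ?_
      filter_upwards [Lp.coeFn_smul r a.snd] with x hx
      simp only [hx, Pi.smul_apply]
      exact smul_comm _ _ _
    change ∫ x in U, ((r • a.fst : L2 U) : E n → ℝ) x • gradient φ x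
      = - ∫ x in U, φ x • ((r • a.snd : L2Vec U) : E n → E n) x
    rw [e1, e2, ha φ hφ, smul_neg]

/-- The Sobolev space `H¹(U)`. -/
abbrev H1 {n : ℕ} (U : Set (E n)) := ↥(h1Subspace U)

/-- The function underlying an element of `H¹(U)`. -/
def H1.fn {n : ℕ} {U : Set (E n)} (u : H1 U) : L2 U := (u : WithLp 2 (L2 U × L2Vec U)).fst

/-- The weak gradient of an element of `H¹(U)`. -/
def H1.grad {n : ℕ} {U : Set (E n)} (u : H1 U) : L2Vec U :=
  (u : WithLp 2 (L2 U × L2Vec U)).snd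

/-- The function `u ∈ H¹(U)` and the smooth function `φ` are `δ`-close in `H¹(U)`. -/
def H1.IsClose {n : ℕ} {U : Set (E n)} (u : H1 U) (φ : E n → ℝ) (δ : ℝ) : Prop :=
  eLpNorm (fun x => u.fn x - φ x) 2 (volume.restrict U) ≤ ENNReal.ofReal δ ∧
  eLpNorm (fun x => u.grad x - gradient φ x) 2 (volume.restrict U) ≤ ENNReal.ofReal δ

/-- `u ∈ H¹₀(U)`: `u` lies in the closure of `C_c^∞(U)` in `H¹(U)`. -/
def H1.MemH10 {n : ℕ} {U : Set (E n)} (u : H1 U) : Prop :=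
  ∀ δ : ℝ, 0 < δ → ∃ φ : E n → ℝ, IsTestFunction U φ ∧ u.IsClose φ δ

/-- `g ∈ L²(S)` is the trace of `u ∈ H¹(U)` on the boundary portion `S`: there are functions
smooth up to the boundary converging to `u` in `H¹(U)` and to `g` in `L²(S)`. -/
def H1.IsTrace {n : ℕ} {U : Set (E n)} (u : H1 U) (S : Set (E n)) (g : E n → ℝ) : Prop :=
  MemLp g 2 ((surfaceMeasure n).restrict S) ∧
  ∀ δ : ℝ, 0 < δ → ∃ φ : E n → ℝ, ContDiff ℝ ∞ φ ∧ HasCompactSupport φ ∧ u.IsClose φ δ ∧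
    eLpNorm (fun x => g x - φ x) 2 ((surfaceMeasure n).restrict S) ≤ ENNReal.ofReal δ

open Classical in
/-- The trace of `u ∈ H¹(U)` on the boundary portion `S`. For bounded sets `U` with Lipschitz
boundary and `S ⊆ ∂U` it exists and is unique almost everywhere on `S`. -/
def H1.trace {n : ℕ} {U : Set (E n)} (u : H1 U) (S : Set (E n)) : E n → ℝ :=
  if h : ∃ g, u.IsTrace S g then h.choose else 0

/-- Vector fields with components in `H¹(U)`. -/
abbrev H1Vec {n : ℕ} (U : Set (E n)) := PiLp 2 (fun _ : Fin n => H1 U)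

/-- The vector field underlying an element of `H¹(U)ⁿ`. -/
def H1Vec.fn {n : ℕ} {U : Set (E n)} (V : H1Vec U) (x : E n) : E n :=
  WithLp.toLp 2 (fun i => (V i).fn x)

/-- The divergence. -/
def H1Vec.div {n : ℕ} {U : Set (E n)} (V : H1Vec U) (x : E n) : ℝ := ∑ i, (V i).grad x i

/-- `V ∈ H¹₀(U)ⁿ`. -/
def H1Vec.MemH10 {n : ℕ} {U : Set (E n)} (V : H1Vec U) : Prop := ∀ i, (V i).MemH10

/-! ## Functions of time -/

/-- Lebesgue measure on `(0,T)`; thus `u ∈ L^q(0,T;X)` is `MemLp u q (timeMeasure T)`. -/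
def timeMeasure (T : ℝ) : Measure ℝ := volume.restrict (Ioo 0 T)

/-- `g = ∂ₜ c` in the sense of distributions on `(0,T)` with values in `(H¹(U))'`, where
`H¹(U)` is embedded in its dual through the inner product of `L²(U)`. -/
def IsWeakTimeDeriv {n : ℕ} {U : Set (E n)} (T : ℝ) (c : ℝ → H1 U)
    (g : ℝ → StrongDual ℝ (H1 U)) : Prop :=
  ∀ (φ : H1 U) (η : ℝ → ℝ), ContDiff ℝ ∞ η → HasCompactSupport η → tsupport η ⊆ Ioo 0 T →
    ∫ t, deriv η t * ⟪(c t).fn, φ.fn⟫ ∂(timeMeasure T)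
      = - ∫ t, η t * g t φ ∂(timeMeasure T)

/-- `c = c₀` at `t = 0`: the representative of `c` in `C([0,T];L²(U))` takes the value `c₀`. -/
def HasInitialValue {n : ℕ} {U : Set (E n)} (T : ℝ) (c : ℝ → H1 U) (c₀ : E n → ℝ) : Prop :=
  ∃ C : ℝ → L2 U, ContinuousOn C (Icc 0 T) ∧ (∀ᵐ t ∂(timeMeasure T), C t = (c t).fn) ∧
    ∀ᵐ x ∂(volume.restrict U), C 0 x = c₀ x

/-! ## Weak solutions of the modified Stokes-Nernst-Planck-Poisson problem -/

/-- Weak formulation of the Stokes equations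
`-ε² Δv + ∇p = -ε^β (c⁺ - c⁻) ∇Φ`, `∇·v = 0` with no-slip boundary condition. -/
structure SolvesStokes {n : ℕ} (U : Set (E n)) (ε β T : ℝ)
    (v : ℝ → H1Vec U) (p : ℝ → L2 U) (Φ cp cm : ℝ → H1 U) : Prop where
  velocity_mem : MemLp v ⊤ (timeMeasure T)
  no_slip : ∀ᵐ t ∂(timeMeasure T), (v t).MemH10
  pressure_mem : MemLp p ⊤ (timeMeasure T)
  momentum : ∀ᵐ t ∂(timeMeasure T), ∀ φ : H1Vec U, φ.MemH10 →
    Integrable (fun x => -(ε ^ β * ((cp t).fn x - (cm t).fn x) * ⟪(Φ t).grad x, φ.fn x⟫))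
      (volume.restrict U) ∧
    ∫ x in U, (ε ^ 2 * (∑ i, ⟪((v t) i).grad x, (φ i).grad x⟫) - p t x * φ.div x)
      = ∫ x in U, -(ε ^ β * ((cp t).fn x - (cm t).fn x) * ⟪(Φ t).grad x, φ.fn x⟫)
  incompressible : ∀ᵐ t ∂(timeMeasure T), ∀ ψ : H1 U,
    ∫ x in U, ⟪(v t).fn x, ψ.grad x⟫ = 0

/-- Weak formulation of the Poisson equation `-ε^α ΔΦ = c⁺ - c⁻` with `Φ = Φ_D` on the part `ΓD`
of the inner boundary `Γ`, `ε^α ∇Φ·ν = ε σ` on the remaining part of `Γ`, and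
`ε^α ∇Φ·ν = 0` on the outer boundary. -/
structure SolvesPoisson {n : ℕ} (U Γ ΓD : Set (E n)) (ε α σ ΦD T : ℝ)
    (Φ cp cm : ℝ → H1 U) : Prop where
  potential_mem : MemLp Φ ⊤ (timeMeasure T)
  dirichlet : ∀ᵐ t ∂(timeMeasure T),
    ∀ᵐ x ∂((surfaceMeasure n).restrict ΓD), (Φ t).trace Γ x = ΦD
  equation : ∀ᵐ t ∂(timeMeasure T), ∀ φ : H1 U,
    (∀ᵐ x ∂((surfaceMeasure n).restrict ΓD), φ.trace Γ x = 0) →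
      (∫ x in U, ε ^ α * ⟪(Φ t).grad x, φ.grad x⟫)
        - (∫ x in Γ \ ΓD, ε * σ * φ.trace Γ x ∂(surfaceMeasure n))
        = ∫ x in U, ((cp t).fn x - (cm t).fn x) * φ.fn x

/-- The total flux paired with `∇φ`: `(-v c + ∇c + z ε^γ max(0,c) ∇Φ) · ∇φ`, with `z = ± 1` and
the concentration in the drift term cut off at zero. -/
def fluxTerm {n : ℕ} {U : Set (E n)} (z ε γ : ℝ) (v : H1Vec U) (Φ c φ : H1 U) (x : E n) : ℝ :=
  ⟪-(c.fn x • v.fn x) + c.grad x + (z * ε ^ γ * max 0 (c.fn x)) • Φ.grad x, φ.grad x⟫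

/-- Weak formulation of the modified Nernst-Planck equation
`∂ₜc + ∇·(v c - ∇c - z ε^γ max(0,c) ∇Φ) = -z (c⁺ - c⁻)` with no-flux boundary condition and
initial value `c₀`, where `c = c⁺` for `z = 1` and `c = c⁻` for `z = -1`. The equation
presupposes that the flux term is integrable. -/
structure SolvesNernstPlanck {n : ℕ} (U : Set (E n)) (z ε γ T : ℝ) (c₀ : E n → ℝ)
    (v : ℝ → H1Vec U) (Φ cp cm c : ℝ → H1 U) : Prop where
  mem_Linfty_L2 : MemLp (fun t => (c t).fn) ⊤ (timeMeasure T)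
  mem_L2_H1 : MemLp c 2 (timeMeasure T)
  initial : HasInitialValue T c c₀
  equation : ∃ g : ℝ → StrongDual ℝ (H1 U), MemLp g 2 (timeMeasure T) ∧ IsWeakTimeDeriv T c g ∧
    ∀ᵐ t ∂(timeMeasure T), ∀ φ : H1 U,
      Integrable (fluxTerm z ε γ (v t) (Φ t) (c t) φ) (volume.restrict U) ∧
      g t φ + (∫ x in U, fluxTerm z ε γ (v t) (Φ t) (c t) φ x)
        = ∫ x in U, -(z * ((cp t).fn x - (cm t).fn x)) * φ.fn x

/-- `(v, p, Φ, c⁺, c⁻)` is a weak solution of the modified problem in the pore space `U` with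
inner boundary `Γ`, Dirichlet part `ΓD`, boundary data `σ`, `ΦD` and initial data `c₀⁺`, `c₀⁻`. -/
structure IsWeakSolution {n : ℕ} (U Γ ΓD : Set (E n)) (ε α β γ σ ΦD T : ℝ)
    (c₀p c₀m : E n → ℝ) (v : ℝ → H1Vec U) (p : ℝ → L2 U) (Φ cp cm : ℝ → H1 U) : Prop where
  stokes : SolvesStokes U ε β T v p Φ cp cm
  poisson : SolvesPoisson U Γ ΓD ε α σ ΦD T Φ cp cm
  nernst_planck_pos : SolvesNernstPlanck U 1 ε γ T c₀p v Φ cp cm cp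
  nernst_planck_neg : SolvesNernstPlanck U (-1) ε γ T c₀m v Φ cp cm cm

/-- Volume additivity constraint: `c⁺ + c⁻ = 1` almost everywhere in `(0,T) × U`. -/
def VolumeAdditivity {n : ℕ} {U : Set (E n)} (T : ℝ) (cp cm : ℝ → H1 U) : Prop :=
  ∀ᵐ t ∂(timeMeasure T), ∀ᵐ x ∂(volume.restrict U), (cp t).fn x + (cm t).fn x = 1

/-- `c ≤ M` almost everywhere in `(0,T) × U`. -/
def BoundedAboveBy {n : ℕ} {U : Set (E n)} (T : ℝ) (c : ℝ → H1 U) (M : ℝ) : Prop :=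
  ∀ᵐ t ∂(timeMeasure T), ∀ᵐ x ∂(volume.restrict U), (c t).fn x ≤ M

end SNPP

end

/-!
Test the equation of `c` with `φ = min (c - L)₊ 1`, the primitive of the indicator of `(L, L + 1]`
evaluated at `c`; the truncation at `1` keeps all test functions in `H¹`. Their gradients are
multiples `f(c) ∇c`, so the convective term is `∫ v · ∇F(c) = 0` for a primitive `F`, diffusion is
dissipative, and the drift is `± ε^γ ∫ ∇Φ · ∇χ`, where `χ` is the moment with
`∇χ = c ∇φ`. If the drift and the reaction together have the good sign, then the convex energy
`∫ E(c)`, `E' = min (· - L)₊ 1`, cannot increase, so `c ≤ L` propagates from the initial time.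

* Homogeneous Neumann conditions allow the test function `χ⁺ - χ⁻` in the Poisson equation, so the
  drifts of both species sum up to a negative multiple of `∫ (c⁺ - c⁻) (χ⁺ - χ⁻) ≥ 0`.
* Under volume additivity the two equations add up to `∫ (m(c⁺) - m(c⁻)) ∇Φ · ∇θ = 0` with
  `m = max 0`. Here `m(c) - m(1 - c) > 0` for `c > 1/2`, so a test function with
  `∇θ = c ∇φ / (m(c) - m(1 - c))` shows that the drift of each species vanishes separately.

No chain rule in time is available for the weak derivative `∂ₜc`. It is replaced by the convexity
inequality `E(c(t)) - E(c(s)) ≤ E'(c(t)) (c(t) - c(s))`, whose right side integrates to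
`∫ₛᵗ ⟨∂ₜc(r), φ(t)⟩ dr`. Taking `s = t - τ` and integrating over `t`, the error of replacing
`∂ₜc(r)` by `∂ₜc(t)` is `o(τ)`, since translations are continuous in `L²`.
-/

noncomputable section

namespace SNPP

open scoped ENNReal NNReal Convolution

/-- The average of the translates of `g` with the weight of a normalised bump function. -/
def mollify {V F : Type*} [NormedAddCommGroup V] [NormedSpace ℝ V] [FiniteDimensional ℝ V]
    [MeasurableSpace V] [NormedAddCommGroup F] [NormedSpace ℝ F]
    (μ : Measure V) (φ : ContDiffBump (0 : V)) (g : V → F) : V → F :=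
  φ.normed μ ⋆[ContinuousLinearMap.lsmul ℝ ℝ, μ] g

section Translation

variable {V F : Type*} [NormedAddCommGroup V] [NormedSpace ℝ V] [FiniteDimensional ℝ V]
  [MeasurableSpace V] [BorelSpace V] [NormedAddCommGroup F] {μ : Measure V} [μ.IsAddHaarMeasure]

theorem tendsto_eLpNorm_translate_sub {p : ℝ≥0∞} [Fact (1 ≤ p)] (hp : p ≠ ⊤) {g : V → F}
    (hg : MemLp g p μ) :
    Tendsto (fun y => eLpNorm (fun x => g (x - y) - g x) p μ) (𝓝 0) (𝓝 0) := by
  let τ : C(V, C(V, V)) :=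
    (ContinuousMap.mk (fun a : V × V => a.2 - a.1) (by fun_prop)).curry
  have hτ : ∀ y, MeasurePreserving (τ y) μ μ := fun y => measurePreserving_sub_right μ y
  have translate_tendsto : Tendsto (fun y => Lp.compMeasurePreserving (τ y) (hτ y) hg.toLp) (𝓝 0)
      (𝓝 (Lp.compMeasurePreserving (τ 0) (hτ 0) hg.toLp)) :=
    Tendsto.compMeasurePreservingLp tendsto_const_nhds (τ.continuous.tendsto 0) hτ (hτ 0) hp
  have translate_ae_eq : ∀ y, Lp.compMeasurePreserving (τ y) (hτ y) hg.toLp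
      =ᵐ[μ] fun x => g (x - y) := fun y =>
    (Lp.coeFn_compMeasurePreserving hg.toLp (hτ y)).trans
      ((hτ y).quasiMeasurePreserving.ae_eq_comp hg.coeFn_toLp)
  refine (tendsto_iff_edist_tendsto_0.1 translate_tendsto).congr fun y => ?_
  rw [Lp.edist_def]
  refine eLpNorm_congr_ae ?_
  filter_upwards [translate_ae_eq 0, translate_ae_eq y] with x h0 hy
  rw [Pi.sub_apply, h0, hy, sub_zero]

theorem aemeasurable_mul_enorm_translate_sub {g : V → F} (hg : AEStronglyMeasurable g μ)
    {b : V → ℝ} (hb : AEStronglyMeasurable b μ) {ρ : V → ℝ≥0∞} (hρ : Measurable ρ) :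
    AEMeasurable (Function.uncurry fun x y => ‖b x‖ₑ * (ρ y * ‖g (x - y) - g x‖ₑ))
      (μ.prod μ) := by
  have translate : AEStronglyMeasurable (fun q : V × V => g (q.1 - q.2)) (μ.prod μ) :=
    hg.comp_quasiMeasurePreserving (quasiMeasurePreserving_sub μ μ)
  exact hb.comp_fst.enorm.mul
    ((hρ.comp measurable_snd).aemeasurable.mul (translate.sub hg.comp_fst).enorm)

theorem lintegral_enorm_mul_enorm_le {α : Type*} [MeasurableSpace α] {ν : Measure α}
    {p q : ℝ≥0∞} [p.HolderConjugate q] {g : α → F} (hg : AEStronglyMeasurable g ν)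
    {b : α → ℝ} (hb : AEStronglyMeasurable b ν) :
    ∫⁻ x, ‖b x‖ₑ * ‖g x‖ₑ ∂ν ≤ eLpNorm b q ν * eLpNorm g p ν := by
  have holder : ENNReal.HolderTriple q p 1 := ENNReal.HolderConjugate.symm (p := p)
  have h := eLpNorm_smul_le_mul_eLpNorm (p := q) (q := p) (r := 1) hg.norm hb
  simpa [eLpNorm_one_eq_lintegral_enorm, enorm_mul] using h

/-- With `b = 1` this is the `L¹` convergence of mollifications, with `b ∈ L²` and `ρ` the indicator
of `(0, τ)` it controls backward averages in time. -/
theorem eventually_lintegral_mul_translate_sub_le {p q : ℝ≥0∞} [p.HolderConjugate q] (hp : p ≠ ⊤)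
    {g : V → F} (hg : MemLp g p μ) {b : V → ℝ} (hb : MemLp b q μ) {η : ℝ≥0∞} (hη : 0 < η) :
    ∀ᶠ δ in 𝓝[>] (0 : ℝ), ∀ ρ : V → ℝ≥0∞, Measurable ρ →
      Function.support ρ ⊆ Metric.ball 0 δ →
      ∫⁻ x, ‖b x‖ₑ * ∫⁻ y, ρ y * ‖g (x - y) - g x‖ₑ ∂μ ∂μ ≤ η * ∫⁻ y, ρ y ∂μ := by
  have : Fact (1 ≤ p) := ⟨ENNReal.HolderConjugate.one_le p q⟩
  have product_tendsto : Tendsto (fun y => eLpNorm b q μ * eLpNorm (fun x => g (x - y) - g x) p μ)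
      (𝓝 0) (𝓝 0) := by
    simpa using ENNReal.Tendsto.const_mul (tendsto_eLpNorm_translate_sub hp hg)
      (Or.inr hb.eLpNorm_ne_top)
  obtain ⟨δ₀, hδ₀, small⟩ :=
    Metric.eventually_nhds_iff.1 (ENNReal.tendsto_nhds_zero.1 product_tendsto η hη)
  filter_upwards [Ioo_mem_nhdsGT hδ₀] with δ hδ ρ hρ hsupp
  have measurable_prod := aemeasurable_mul_enorm_translate_sub hg.1 hb.1 hρ
  have slice : ∀ y, ∫⁻ x, ‖b x‖ₑ * (ρ y * ‖g (x - y) - g x‖ₑ) ∂μ ≤ η * ρ y := fun y => by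
    by_cases hy : ρ y = 0
    · simp [hy]
    have translate : AEStronglyMeasurable (fun x => g (x - y)) μ :=
      hg.1.comp_quasiMeasurePreserving (measurePreserving_sub_right μ y).quasiMeasurePreserving
    have integrand_aemeasurable : AEMeasurable (fun x => ‖b x‖ₑ * ‖g (x - y) - g x‖ₑ) μ :=
      hb.1.enorm.mul (translate.sub hg.1).enorm
    simp_rw [mul_left_comm _ (ρ y)]
    rw [lintegral_const_mul'' _ integrand_aemeasurable, mul_comm η]
    gcongr
    exact (lintegral_enorm_mul_enorm_le (translate.sub hg.1) hb.1).trans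
      (small ((hsupp hy).trans hδ.2))
  calc ∫⁻ x, ‖b x‖ₑ * ∫⁻ y, ρ y * ‖g (x - y) - g x‖ₑ ∂μ ∂μ
      = ∫⁻ x, ∫⁻ y, ‖b x‖ₑ * (ρ y * ‖g (x - y) - g x‖ₑ) ∂μ ∂μ := by
        simp_rw [lintegral_const_mul' _ _ enorm_ne_top]
    _ = ∫⁻ y, ∫⁻ x, ‖b x‖ₑ * (ρ y * ‖g (x - y) - g x‖ₑ) ∂μ ∂μ :=
        lintegral_lintegral_swap measurable_prod
    _ ≤ ∫⁻ y, η * ρ y ∂μ := lintegral_mono slice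
    _ = η * ∫⁻ y, ρ y ∂μ := lintegral_const_mul _ hρ

variable [NormedSpace ℝ F] [CompleteSpace F]

theorem enorm_mollify_sub_le (φ : ContDiffBump (0 : V)) {g : V → F} (hg : Integrable g μ)
    (x : V) : ‖mollify μ φ g x - g x‖ₑ ≤
      ∫⁻ y, ENNReal.ofReal (φ.normed μ y) * ‖g (x - y) - g x‖ₑ ∂μ := by
  have integrable_translate : Integrable (fun y => φ.normed μ y • g (x - y)) μ :=
    φ.hasCompactSupport_normed.convolutionExists_left (ContinuousLinearMap.lsmul ℝ ℝ)
      φ.continuous_normed hg.locallyIntegrable x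
  have average_sub : mollify μ φ g x - g x = ∫ y, φ.normed μ y • (g (x - y) - g x) ∂μ := by
    simp_rw [smul_sub]
    rw [integral_sub integrable_translate (φ.integrable_normed.smul_const _),
      φ.integral_normed_smul]
    rfl
  rw [average_sub]
  refine (enorm_integral_le_lintegral_enorm _).trans (lintegral_mono fun y => ?_)
  rw [enorm_smul, Real.enorm_eq_ofReal (φ.nonneg_normed y)]

theorem tendsto_lintegral_mollify_sub {φ : ℕ → ContDiffBump (0 : V)}
    (hφ : Tendsto (fun i => (φ i).rOut) atTop (𝓝 0)) {g : V → F} (hg : Integrable g μ) :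
    Tendsto (fun i => ∫⁻ x, ‖mollify μ (φ i) g x - g x‖ₑ ∂μ) atTop (𝓝 0) := by
  have hφ' : Tendsto (fun i => (φ i).rOut) atTop (𝓝[>] 0) :=
    tendsto_nhdsWithin_iff.2 ⟨hφ, Eventually.of_forall fun i => (φ i).rOut_pos⟩
  have normed_mass : ∀ i, ∫⁻ y, ENNReal.ofReal ((φ i).normed μ y) ∂μ = 1 := fun i => by
    rw [← ofReal_integral_eq_lintegral_ofReal (φ i).integrable_normed
      (Eventually.of_forall (φ i).nonneg_normed), (φ i).integral_normed, ENNReal.ofReal_one]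
  refine ENNReal.tendsto_nhds_zero.2 fun η hη => ?_
  filter_upwards [hφ'.eventually (eventually_lintegral_mul_translate_sub_le (p := 1) (q := ⊤)
    ENNReal.one_ne_top (memLp_one_iff_integrable.2 hg) (memLp_top_const (1 : ℝ)) hη)] with i hi
  have averaged := hi (fun y => ENNReal.ofReal ((φ i).normed μ y))
    (φ i).continuous_normed.measurable.ennreal_ofReal (fun y hy => by
      rw [← (φ i).support_normed_eq (μ := μ)]
      exact fun h => hy (by simp [h]))
  simp only [enorm_one, one_mul, normed_mass, mul_one] at averaged
  exact (lintegral_mono fun x => enorm_mollify_sub_le (φ i) hg x).trans averaged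

end Translation

section BilinearLimits

variable {α F₁ F₂ F₃ : Type*} [MeasurableSpace α] {μ : Measure α}
  [NormedAddCommGroup F₁] [NormedSpace ℝ F₁] [NormedAddCommGroup F₂] [NormedSpace ℝ F₂]
  [NormedAddCommGroup F₃] [NormedSpace ℝ F₃] (L : F₁ →L[ℝ] F₂ →L[ℝ] F₃)

theorem tendsto_lintegral_bilin_sub {f : ℕ → α → F₁} {f' : α → F₁} {g : ℕ → α → F₂} {g' : α → F₂}
    {B : ℝ} (hf : ∀ i, AEStronglyMeasurable (f i) μ) (hB : ∀ i x, ‖f i x‖ ≤ B)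
    (hf' : ∀ᵐ x ∂μ, Tendsto (fun i => f i x) atTop (𝓝 (f' x))) (hg' : Integrable g' μ)
    (hg : Tendsto (fun i => ∫⁻ x, ‖g i x - g' x‖ₑ ∂μ) atTop (𝓝 0)) :
    Tendsto (fun i => ∫⁻ x, ‖L (f i x) (g i x) - L (f' x) (g' x)‖ₑ ∂μ) atTop (𝓝 0) := by
  have measurable_i := fun i => L.aestronglyMeasurable_comp₂ (hf i) hg'.1
  have pointwise : ∀ᵐ x ∂μ, Tendsto (fun i => L (f i x) (g' x)) atTop (𝓝 (L (f' x) (g' x))) := by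
    filter_upwards [hf'] with x hx
    exact ((L.flip (g' x)).continuous.tendsto _).comp hx
  have frozen_second : Tendsto (fun i => ∫⁻ x, ‖L (f i x) (g' x) - L (f' x) (g' x)‖ₑ ∂μ)
      atTop (𝓝 0) := by
    have dominating : Integrable (fun x => ‖L‖ * B * ‖g' x‖) μ := hg'.norm.const_mul _
    simpa only [ofReal_norm] using tendsto_lintegral_norm_of_dominated_convergence measurable_i
      dominating.2 (fun i => Eventually.of_forall fun x =>
        (L.le_opNorm₂ _ _).trans <| by gcongr; exact hB i x) pointwise
  have frozen_first : Tendsto (fun i => ENNReal.ofReal (‖L‖ * B) * ∫⁻ x, ‖g i x - g' x‖ₑ ∂μ)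
      atTop (𝓝 0) := by
    simpa using ENNReal.Tendsto.const_mul hg (Or.inr ENNReal.ofReal_ne_top)
  refine tendsto_of_tendsto_of_tendsto_of_le_of_le tendsto_const_nhds
    (by simpa using frozen_first.add frozen_second) (fun _ => zero_le) fun i => ?_
  have measurable_sub : AEMeasurable (fun x => ‖L (f i x) (g' x) - L (f' x) (g' x)‖ₑ) μ :=
    ((measurable_i i).sub (aestronglyMeasurable_of_tendsto_ae atTop measurable_i pointwise)).enorm
  beta_reduce
  rw [← lintegral_const_mul' _ _ ENNReal.ofReal_ne_top, ← lintegral_add_right' _ measurable_sub]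
  refine lintegral_mono fun x => ?_
  calc ‖L (f i x) (g i x) - L (f' x) (g' x)‖ₑ
      = ‖L (f i x) (g i x - g' x) + (L (f i x) (g' x) - L (f' x) (g' x))‖ₑ := by
        rw [map_sub, sub_add_sub_cancel]
    _ ≤ ‖L (f i x) (g i x - g' x)‖ₑ + ‖L (f i x) (g' x) - L (f' x) (g' x)‖ₑ := enorm_add_le _ _
    _ ≤ _ := by
        gcongr
        rw [← ofReal_norm, ← ofReal_norm, ← ENNReal.ofReal_mul' (norm_nonneg _)]
        exact ENNReal.ofReal_le_ofReal ((L.le_opNorm₂ _ _).trans <| by gcongr; exact hB i x)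

theorem tendsto_setIntegral_bilin_of_tsupport_subset [TopologicalSpace α]
    [OpensMeasurableSpace α] [SecondCountableTopologyEither α F₁] {U : Set α}
    (hU : MeasurableSet U) {ψ : α → F₁} (hψ : Continuous ψ) (hc : HasCompactSupport ψ)
    (hψU : tsupport ψ ⊆ U) {g : ℕ → α → F₂} {g' : α → F₂}
    (hg : ∀ i, IntegrableOn (g i) (tsupport ψ) μ) (hg' : IntegrableOn g' (tsupport ψ) μ)
    (hlim : Tendsto (fun i => ∫⁻ x in tsupport ψ, ‖g i x - g' x‖ₑ ∂μ) atTop (𝓝 0)) :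
    Tendsto (fun i => ∫ x in U, L (ψ x) (g i x) ∂μ) atTop (𝓝 (∫ x in U, L (ψ x) (g' x) ∂μ)) := by
  obtain ⟨B, hB⟩ := hψ.bounded_above_of_compact_support hc
  have restrict_tsupport : ∀ f : α → F₂,
      ∫ x in U, L (ψ x) (f x) ∂μ = ∫ x in tsupport ψ, L (ψ x) (f x) ∂μ := fun f =>
    setIntegral_eq_of_subset_of_forall_sdiff_eq_zero hU hψU fun x hx => by
      rw [image_eq_zero_of_notMem_tsupport hx.2, map_zero, zero_apply]
  simp_rw [restrict_tsupport]
  refine tendsto_integral_of_L1 _ (L.aestronglyMeasurable_comp₂ hψ.aestronglyMeasurable hg'.1)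
    (Eventually.of_forall fun i => ?_) (tendsto_lintegral_bilin_sub L
      (fun _ => hψ.aestronglyMeasurable) (fun _ => hB) (Eventually.of_forall fun _ =>
        tendsto_const_nhds) hg' hlim)
  exact ((hg i).norm.const_mul (‖L‖ * B)).mono'
    (L.aestronglyMeasurable_comp₂ hψ.aestronglyMeasurable (hg i).1) (Eventually.of_forall fun x =>
      (L.le_opNorm₂ _ _).trans <| by gcongr; exact hB x)

end BilinearLimits

section WeakGradient

variable {n : ℕ} {U : Set (E n)} {u : E n → ℝ} {G : E n → E n}

theorem inner_gradient (f : E n → ℝ) (x v : E n) : ⟪gradient f x, v⟫ = fderiv ℝ f x v := by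
  simp [gradient]

theorem gradient_comp_const_sub {f : E n → ℝ} {x y : E n} (hf : DifferentiableAt ℝ f (x - y)) :
    gradient (fun z => f (x - z)) y = -gradient f (x - y) := by
  have hasFDerivAt_comp : HasFDerivAt (fun z => f (x - z)) _ y :=
    hf.hasFDerivAt.comp y ((hasFDerivAt_id y).const_sub x)
  refine ext_inner_right ℝ fun v => ?_
  rw [inner_neg_left, inner_gradient, inner_gradient, hasFDerivAt_comp.fderiv]
  simp

theorem continuous_gradient {f : E n → ℝ} (hf : ContDiff ℝ 1 f) : Continuous (gradient f) :=
  (InnerProductSpace.toDual ℝ (E n)).symm.continuous.comp (hf.continuous_fderiv one_ne_zero)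

theorem tsupport_gradient_subset (f : E n → ℝ) : tsupport (gradient f) ⊆ tsupport f := by
  refine closure_minimal (fun x hx => support_fderiv_subset ℝ fun h => hx ?_) (isClosed_tsupport f)
  rw [gradient, h, map_zero]

theorem isWeakGradient_of_tendsto (hU : MeasurableSet U) (hu : LocallyIntegrableOn u U)
    (hG : LocallyIntegrableOn G U)
    (H : ∀ K, IsCompact K → K ⊆ U → ∃ (w : ℕ → E n → ℝ) (W : ℕ → E n → E n),
      (∀ i, IsWeakGradient U (w i) (W i) ∧ IntegrableOn (w i) K ∧ IntegrableOn (W i) K) ∧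
      Tendsto (fun i => ∫⁻ x in K, ‖w i x - u x‖ₑ) atTop (𝓝 0) ∧
      Tendsto (fun i => ∫⁻ x in K, ‖W i x - G x‖ₑ) atTop (𝓝 0)) :
    IsWeakGradient U u G := by
  intro φ hφ
  obtain ⟨w, W, hw, w_tendsto, W_tendsto⟩ := H (tsupport φ) hφ.compact hφ.support
  have hsub := tsupport_gradient_subset φ
  have left_side := tendsto_setIntegral_bilin_of_tsupport_subset (μ := volume)
    (ContinuousLinearMap.lsmul ℝ ℝ (E := E n)).flip hU hφ.continuous_gradient hφ.compact_gradient
    (hsub.trans hφ.support) (fun i => (hw i).2.1.mono_set hsub)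
    ((hu.integrableOn_compact_subset hφ.support hφ.compact).mono_set hsub)
    (tendsto_of_tendsto_of_tendsto_of_le_of_le tendsto_const_nhds w_tendsto (fun _ => zero_le)
      fun i => lintegral_mono_set hsub)
  have right_side := tendsto_setIntegral_bilin_of_tsupport_subset (μ := volume)
    (ContinuousLinearMap.lsmul ℝ ℝ (E := E n)) hU hφ.smooth.continuous hφ.compact hφ.support
    (fun i => (hw i).2.2) (hG.integrableOn_compact_subset hφ.support hφ.compact) W_tendsto
  exact tendsto_nhds_unique left_side (right_side.neg.congr fun i => ((hw i).1 φ hφ).symm)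

theorem isWeakGradient_gradient {f : E n → ℝ} (hf : ContDiff ℝ 1 f) :
    IsWeakGradient U f (gradient f) := by
  intro φ hφ
  have extend : ∀ F : E n → E n, tsupport F ⊆ tsupport φ → ∫ x in U, F x = ∫ x, F x := fun F hF =>
    setIntegral_eq_integral_of_forall_compl_eq_zero fun x hx =>
      image_eq_zero_of_notMem_tsupport fun h => hx (hφ.support (hF h))
  have left_continuous : Continuous fun x => f x • gradient φ x :=
    hf.continuous.smul hφ.continuous_gradient
  have right_continuous : Continuous fun x => φ x • gradient f x :=
    hφ.smooth.continuous.smul (continuous_gradient hf)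
  rw [extend (fun x => f x • gradient φ x) ((tsupport_smul_subset_right f _).trans
    (tsupport_gradient_subset φ)), extend _ (tsupport_smul_subset_left φ _)]
  refine ext_inner_left ℝ fun v => ?_
  rw [inner_neg_right, ← integral_inner, ← integral_inner]
  · simp only [real_inner_comm _ v, real_inner_smul_left, inner_gradient]
    rw [integral_mul_fderiv_eq_neg_fderiv_mul_of_integrable]
    · simp only [mul_comm]
    · exact (((hf.continuous_fderiv one_ne_zero).clm_apply continuous_const).mul
        hφ.smooth.continuous).integrable_of_hasCompactSupport hφ.compact.mul_left
    · exact (hf.continuous.mul ((hφ.smooth.continuous_fderiv (by simp)).clm_apply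
        continuous_const)).integrable_of_hasCompactSupport (hφ.compact.fderiv_apply ℝ v).mul_left
    · exact (hf.continuous.mul hφ.smooth.continuous).integrable_of_hasCompactSupport
        hφ.compact.mul_left
    · exact fun x _ => hf.differentiable one_ne_zero x
    · exact fun x _ => hφ.smooth.differentiable (by simp) x
  · exact right_continuous.integrable_of_hasCompactSupport
      (hφ.compact.smul_right (f' := gradient f))
  · exact left_continuous.integrable_of_hasCompactSupport (hφ.compact_gradient.smul_left (f := f))

end WeakGradient

section Mollification

variable {n : ℕ} {U : Set (E n)} {u : E n → ℝ} {G : E n → E n}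

theorem isTestFunction_normed_sub (φ : ContDiffBump (0 : E n)) {x : E n}
    (hx : Metric.closedBall x φ.rOut ⊆ U) :
    IsTestFunction U fun y => φ.normed volume (x - y) := by
  have tsupport_subset :
      tsupport (fun y => φ.normed volume (x - y)) ⊆ Metric.closedBall x φ.rOut := by
    refine closure_minimal (fun y hy => ?_) Metric.isClosed_closedBall
    have mem_support : x - y ∈ Function.support (φ.normed volume) := hy
    rw [φ.support_normed_eq, mem_ball_zero_iff] at mem_support
    rw [Metric.mem_closedBall, dist_comm, dist_eq_norm]
    exact mem_support.le
  exact ⟨φ.contDiff_normed.comp (contDiff_const.sub contDiff_id),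
    (isCompact_closedBall x φ.rOut).of_isClosed_subset (isClosed_tsupport _) tsupport_subset,
    tsupport_subset.trans hx⟩

theorem contDiff_mollify (φ : ContDiffBump (0 : E n)) (hu : LocallyIntegrable u) :
    ContDiff ℝ 1 (mollify volume φ u) :=
  φ.hasCompactSupport_normed.contDiff_convolution_left _ φ.contDiff_normed hu

theorem gradient_mollify (φ : ContDiffBump (0 : E n)) (hu : LocallyIntegrable u) (x : E n) :
    gradient (mollify volume φ u) x = ∫ y, u y • gradient (φ.normed volume) (x - y) := by
  have normed_contDiff : ContDiff ℝ 1 (φ.normed volume) := φ.contDiff_normed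
  have normed_compact : HasCompactSupport (φ.normed volume) := φ.hasCompactSupport_normed
  have integrable_smul : Integrable fun y => u y • gradient (φ.normed volume) (x - y) :=
    HasCompactSupport.convolutionExists_right (ContinuousLinearMap.lsmul ℝ ℝ)
      (normed_compact.mono' ((subset_tsupport _).trans (tsupport_gradient_subset _))) hu
      (continuous_gradient normed_contDiff) x
  have convolution_comm : mollify volume φ u =
      u ⋆[(ContinuousLinearMap.lsmul ℝ ℝ : ℝ →L[ℝ] ℝ →L[ℝ] ℝ).flip, volume] φ.normed volume := by
    rw [mollify, ← convolution_flip]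
  refine ext_inner_right ℝ fun v => ?_
  rw [inner_gradient, convolution_comm, (normed_compact.hasFDerivAt_convolution_right _ hu
    normed_contDiff x).fderiv, convolution_precompR_apply _ hu (normed_compact.fderiv (𝕜 := ℝ))
    (normed_contDiff.continuous_fderiv one_ne_zero), convolution_def, real_inner_comm,
    ← integral_inner integrable_smul]
  simp only [real_inner_comm _ v, real_inner_smul_left, inner_gradient,
    ContinuousLinearMap.flip_apply, ContinuousLinearMap.lsmul_apply, smul_eq_mul, mul_comm]

theorem IsWeakGradient.gradient_mollify (hU : MeasurableSet U) (h : IsWeakGradient U u G)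
    (hu : IntegrableOn u U) (φ : ContDiffBump (0 : E n)) {x : E n}
    (hx : Metric.closedBall x φ.rOut ⊆ U) :
    gradient (mollify volume φ (U.indicator u)) x = mollify volume φ (U.indicator G) x := by
  have gradient_translate : ∀ y, gradient (fun z => φ.normed volume (x - z)) y =
      -gradient (φ.normed volume) (x - y) := fun y =>
    gradient_comp_const_sub ((φ.contDiff_normed (n := 1)).differentiable one_ne_zero _)
  have tested := h _ (isTestFunction_normed_sub φ hx)
  simp only [gradient_translate, smul_neg, integral_neg, neg_inj] at tested
  rw [← integral_indicator hU, ← integral_indicator hU, indicator_smul_left, indicator_smul]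
    at tested
  rw [SNPP.gradient_mollify φ ((integrable_indicator_iff hU).2 hu).locallyIntegrable, tested,
    mollify, convolution_eq_swap]
  rfl

end Mollification

section ChainRule

/-- The primitive of `f` vanishing at the origin. -/
def primitive (f : ℝ → ℝ) (s : ℝ) : ℝ := ∫ r in (0 : ℝ)..s, f r

section Primitive

variable {f : ℝ → ℝ} {B : ℝ}

@[simp]
theorem primitive_zero (f : ℝ → ℝ) : primitive f 0 = 0 := intervalIntegral.integral_same

theorem intervalIntegrable_of_abs_le (hf : Measurable f) (hB : ∀ s, |f s| ≤ B) (a b : ℝ) :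
    IntervalIntegrable f volume a b :=
  (intervalIntegrable_const (c := B)).mono_fun hf.aestronglyMeasurable
    (Eventually.of_forall fun s => (hB s).trans (le_abs_self B))

theorem primitive_sub (hf : Measurable f) (hB : ∀ s, |f s| ≤ B) (a b : ℝ) :
    primitive f b - primitive f a = ∫ r in a..b, f r :=
  intervalIntegral.integral_interval_sub_left (intervalIntegrable_of_abs_le hf hB _ _)
    (intervalIntegrable_of_abs_le hf hB _ _)

theorem abs_primitive_sub_le (hf : Measurable f) (hB : ∀ s, |f s| ≤ B) (a b : ℝ) :
    |primitive f b - primitive f a| ≤ B * |b - a| := by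
  rw [primitive_sub hf hB]
  exact intervalIntegral.norm_integral_le_of_norm_le_const (f := f) fun s _ => hB s

theorem abs_primitive_le (hf : Measurable f) (hB : ∀ s, |f s| ≤ B) (s : ℝ) :
    |primitive f s| ≤ B * |s| := by
  simpa using abs_primitive_sub_le hf hB 0 s

theorem continuous_primitive (hf : Measurable f) (hB : ∀ s, |f s| ≤ B) :
    Continuous (primitive f) :=
  intervalIntegral.continuous_primitive (intervalIntegrable_of_abs_le hf hB) 0

theorem hasDerivAt_primitive (hf : Continuous f) (s : ℝ) : HasDerivAt (primitive f) (f s) s :=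
  intervalIntegral.integral_hasDerivAt_right (hf.intervalIntegrable _ _)
    (hf.stronglyMeasurableAtFilter _ _) hf.continuousAt

theorem contDiff_primitive (hf : Continuous f) : ContDiff ℝ 1 (primitive f) :=
  contDiff_one_iff_deriv.2 ⟨fun s => (hasDerivAt_primitive hf s).differentiableAt, by
    rwa [funext fun s => (hasDerivAt_primitive hf s).deriv]⟩

theorem enorm_primitive_sub_primitive_le {g : ℝ → ℝ} (hf : Integrable f) (hg : Integrable g)
    (s : ℝ) : ‖primitive f s - primitive g s‖ₑ ≤ ∫⁻ r, ‖f r - g r‖ₑ := by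
  rw [primitive, primitive, ← intervalIntegral.integral_sub hf.intervalIntegrable
    hg.intervalIntegrable, ← ofReal_norm, intervalIntegral.norm_intervalIntegral_eq, ofReal_norm]
  exact (enorm_integral_le_lintegral_enorm _).trans (setLIntegral_le_lintegral _ _)

end Primitive

variable {n : ℕ} {U : Set (E n)} {u : E n → ℝ} {G : E n → E n}

theorem exists_seq_contDiffBump {V : Type*} [NormedAddCommGroup V] {δ : ℝ} (hδ : 0 < δ) :
    ∃ ρ : ℕ → ContDiffBump (0 : V), (∀ i, (ρ i).rOut ≤ δ) ∧
      (∀ i, (ρ i).rOut ≤ 2 * (ρ i).rIn) ∧ Tendsto (fun i => (ρ i).rOut) atTop (𝓝 0) := by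
  refine ⟨fun i => ⟨δ / (2 * (i + 2)), δ / (i + 2), by positivity, by gcongr; linarith⟩,
    fun i => div_le_self hδ.le (by linarith [show (0 : ℝ) ≤ i by positivity]), fun i => ?_,
    tendsto_const_nhds.div_atTop (tendsto_natCast_atTop_atTop.atTop_add tendsto_const_nhds)⟩
  apply le_of_eq
  field_simp

theorem IsWeakGradient.exists_seq_contDiff (hU : IsOpen U) (h : IsWeakGradient U u G)
    (hu : IntegrableOn u U) (hG : IntegrableOn G U) {K : Set (E n)} (hK : IsCompact K)
    (hKU : K ⊆ U) :
    ∃ w : ℕ → E n → ℝ, (∀ i, ContDiff ℝ 1 (w i)) ∧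
      (∀ᵐ x ∂volume.restrict K, Tendsto (fun i => w i x) atTop (𝓝 (u x))) ∧
      Tendsto (fun i => ∫⁻ x in K, ‖w i x - u x‖ₑ) atTop (𝓝 0) ∧
      Tendsto (fun i => ∫⁻ x in K, ‖gradient (w i) x - G x‖ₑ) atTop (𝓝 0) := by
  obtain ⟨δ, hδ, thickening_subset⟩ := hK.exists_cthickening_subset_open hU hKU
  obtain ⟨ρ, rOut_le, rOut_le_rIn, rOut_tendsto⟩ := exists_seq_contDiffBump (V := E n) hδ
  have hu' : Integrable (U.indicator u) := (integrable_indicator_iff hU.measurableSet).2 hu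
  have hG' : Integrable (U.indicator G) := (integrable_indicator_iff hU.measurableSet).2 hG
  have ball_subset : ∀ i, ∀ x ∈ K, Metric.closedBall x (ρ i).rOut ⊆ U := fun i x hx =>
    (Metric.closedBall_subset_closedBall (rOut_le i)).trans
      ((Metric.closedBall_subset_cthickening hx δ).trans thickening_subset)
  refine ⟨fun i => mollify volume (ρ i) (U.indicator u),
    fun i => contDiff_mollify _ hu'.locallyIntegrable, ?_,
    tendsto_of_tendsto_of_tendsto_of_le_of_le tendsto_const_nhds
      (tendsto_lintegral_mollify_sub rOut_tendsto hu') (fun _ => zero_le) fun i => ?_,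
    tendsto_of_tendsto_of_tendsto_of_le_of_le tendsto_const_nhds
      (tendsto_lintegral_mollify_sub rOut_tendsto hG') (fun _ => zero_le) fun i => ?_⟩
  · filter_upwards [ae_restrict_of_ae
      (ContDiffBump.ae_convolution_tendsto_right_of_locallyIntegrable rOut_tendsto
        (Eventually.of_forall rOut_le_rIn) hu'.locallyIntegrable),
      ae_restrict_mem hK.measurableSet] with x hx hxK
    rwa [indicator_of_mem (hKU hxK)] at hx
  · refine (setLIntegral_mono_ae' hK.measurableSet (Eventually.of_forall fun x hx => ?_)).trans
      (setLIntegral_le_lintegral K _)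
    rw [indicator_of_mem (hKU hx)]
  · refine (setLIntegral_mono_ae' hK.measurableSet (Eventually.of_forall fun x hx => ?_)).trans
      (setLIntegral_le_lintegral K _)
    rw [indicator_of_mem (hKU hx), h.gradient_mollify hU.measurableSet hu _ (ball_subset i x hx)]

theorem gradient_primitive_comp {f : ℝ → ℝ} (hf : Continuous f) {w : E n → ℝ} {x : E n}
    (hw : DifferentiableAt ℝ w x) :
    gradient (fun y => primitive f (w y)) x = f (w x) • gradient w x := by
  have hasFDerivAt_comp : HasFDerivAt (fun y => primitive f (w y)) _ x :=
    (hasDerivAt_primitive hf (w x)).comp_hasFDerivAt x hw.hasFDerivAt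
  rw [gradient, gradient, hasFDerivAt_comp.fderiv, map_smulₛₗ]
  rfl

theorem integrableOn_primitive_comp (hu : IntegrableOn u U) {f : ℝ → ℝ} (hf : Measurable f) {B : ℝ}
    (hB : ∀ s, |f s| ≤ B) : IntegrableOn (fun x => primitive f (u x)) U :=
  (hu.norm.const_mul B).mono' ((continuous_primitive hf hB).comp_aestronglyMeasurable hu.1)
    (Eventually.of_forall fun x => abs_primitive_le hf hB (u x))

theorem locallyIntegrableOn_primitive_comp (hu : AEStronglyMeasurable u (volume.restrict U))
    {f : ℝ → ℝ} (hf : Integrable f) : LocallyIntegrableOn (fun x => primitive f (u x)) U := by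
  have primitive_continuous : Continuous (primitive f) :=
    intervalIntegral.continuous_primitive (fun _ _ => hf.intervalIntegrable) 0
  refine locallyIntegrableOn_of_locallyIntegrable_restrict <|
    (locallyIntegrable_const (∫ r, ‖f r‖)).mono
      (primitive_continuous.comp_aestronglyMeasurable hu) (Eventually.of_forall fun x => ?_)
  calc ‖primitive f (u x)‖ ≤ ∫ r in uIoc 0 (u x), ‖f r‖ :=
        intervalIntegral.norm_integral_le_integral_norm_uIoc
    _ ≤ ∫ r, ‖f r‖ := setIntegral_le_integral hf.norm (Eventually.of_forall fun _ => norm_nonneg _)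
    _ ≤ ‖∫ r, ‖f r‖‖ := le_abs_self _

theorem IsWeakGradient.primitive_comp_of_continuous (hU : IsOpen U) (h : IsWeakGradient U u G)
    (hu : IntegrableOn u U) (hG : IntegrableOn G U) {f : ℝ → ℝ} (hf : Continuous f) {B : ℝ}
    (hB : ∀ s, |f s| ≤ B) :
    IsWeakGradient U (fun x => primitive f (u x)) (fun x => f (u x) • G x) := by
  have smul_integrable : IntegrableOn (fun x => f (u x) • G x) U :=
    hG.bdd_smul B (hf.comp_aestronglyMeasurable hu.1) (Eventually.of_forall fun x => hB (u x))
  refine isWeakGradient_of_tendsto hU.measurableSet 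
    (integrableOn_primitive_comp hu hf.measurable hB).locallyIntegrableOn
    smul_integrable.locallyIntegrableOn fun K hK hKU => ?_
  obtain ⟨w, hw, w_tendsto, w_L1, gradient_L1⟩ := h.exists_seq_contDiff hU hu hG hK hKU
  have comp_contDiff : ∀ i, ContDiff ℝ 1 fun x => primitive f (w i x) := fun i =>
    (contDiff_primitive hf).comp (hw i)
  refine ⟨fun i x => primitive f (w i x), fun i => gradient fun x => primitive f (w i x), fun i =>
    ⟨isWeakGradient_gradient (comp_contDiff i),
      (comp_contDiff i).continuous.continuousOn.integrableOn_compact hK,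
      (continuous_gradient (comp_contDiff i)).continuousOn.integrableOn_compact hK⟩, ?_, ?_⟩
  · refine tendsto_of_tendsto_of_tendsto_of_le_of_le tendsto_const_nhds
      (by simpa using ENNReal.Tendsto.const_mul w_L1 (Or.inr (ENNReal.ofReal_ne_top (r := B))))
      (fun _ => zero_le) fun i => ?_
    beta_reduce
    rw [← lintegral_const_mul' _ _ ENNReal.ofReal_ne_top]
    refine lintegral_mono fun x => ?_
    rw [← ofReal_norm, ← ofReal_norm, ← ENNReal.ofReal_mul' (norm_nonneg _)]
    exact ENNReal.ofReal_le_ofReal (abs_primitive_sub_le hf.measurable hB _ _)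
  · simp only [gradient_primitive_comp hf ((hw _).differentiable one_ne_zero _)]
    exact tendsto_lintegral_bilin_sub (ContinuousLinearMap.lsmul ℝ ℝ)
      (fun i => (hf.comp (hw i).continuous).aestronglyMeasurable) (fun i x => hB (w i x))
      (w_tendsto.mono fun x hx => (hf.tendsto _).comp hx) (hG.mono_set hKU) gradient_L1

theorem exists_hasCompactSupport_approx (hu : AEMeasurable u (volume.restrict U))
    (hG : IntegrableOn G U) {f : ℝ → ℝ} (hf : Measurable f) (hfi : Integrable f)
    (hfG : IntegrableOn (fun x => f (u x) • G x) U) {η : ℝ≥0∞} (hη : η ≠ 0) :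
    ∃ g : ℝ → ℝ, Continuous g ∧ HasCompactSupport g ∧ ∫⁻ r, ‖g r - f r‖ₑ ≤ η ∧
      ∫⁻ x in U, ‖g (u x) • G x - f (u x) • G x‖ₑ ≤ η := by
  set κ : Measure (E n) := (volume.restrict U).withDensity fun x => ‖G x‖ₑ
  have hu' : AEMeasurable u κ := hu.mono_ac (withDensity_absolutelyContinuous _ _)
  have lintegral_map_eq : ∀ k : ℝ → ℝ, Measurable k →
      ∫⁻ r, ‖k r‖ₑ ∂(κ.map u) = ∫⁻ x in U, ‖k (u x) • G x‖ₑ := fun k hk => by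
    rw [lintegral_map' hk.enorm.aemeasurable hu', lintegral_withDensity_eq_lintegral_mul₀
      hG.1.enorm (g := fun x => ‖k (u x)‖ₑ)
      (hk.comp_aemeasurable hu).enorm]
    simp only [Pi.mul_apply, enorm_smul, mul_comm]
  have : IsFiniteMeasure κ := isFiniteMeasure_withDensity hG.2.ne
  have : IsFiniteMeasureOnCompacts (volume + κ.map u) :=
    ⟨fun K hK => ENNReal.add_lt_top.2 ⟨hK.measure_lt_top, measure_lt_top _ _⟩⟩
  have integrable_sum : Integrable f (volume + κ.map u) :=
    hfi.add_measure ⟨hf.aestronglyMeasurable, by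
      rw [HasFiniteIntegral, lintegral_map_eq f hf]; exact hfG.2⟩
  obtain ⟨g, g_compact, g_close, g_continuous, -⟩ :=
    integrable_sum.exists_hasCompactSupport_lintegral_sub_le hη
  simp_rw [enorm_sub_rev (f _), lintegral_add_measure] at g_close
  refine ⟨g, g_continuous, g_compact, le_self_add.trans g_close, ?_⟩
  simp_rw [← sub_smul]
  exact (lintegral_map_eq (fun r => g r - f r) (g_continuous.measurable.sub hf)).symm.le.trans
    (le_add_self.trans g_close)

theorem IsWeakGradient.primitive_comp (hU : IsOpen U) (h : IsWeakGradient U u G)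
    (hu : IntegrableOn u U) (hG : IntegrableOn G U) {f : ℝ → ℝ} (hf : Measurable f)
    (hfi : Integrable f) (hfG : IntegrableOn (fun x => f (u x) • G x) U) :
    IsWeakGradient U (fun x => primitive f (u x)) (fun x => f (u x) • G x) := by
  have mass_ne_zero : ∀ k : ℕ, ((k : ℝ≥0∞) + 1)⁻¹ ≠ 0 := fun k => by simp
  have mass_tendsto : Tendsto (fun k : ℕ => ((k : ℝ≥0∞) + 1)⁻¹) atTop (𝓝 0) := by
    simpa using (tendsto_add_atTop_iff_nat 1).2 ENNReal.tendsto_inv_nat_nhds_zero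
  choose g g_continuous g_compact g_close g_smul_close using fun k =>
    exists_hasCompactSupport_approx hu.1.aemeasurable hG hf hfi hfG (mass_ne_zero k)
  choose B hB using fun k => (g_compact k).exists_bound_of_continuous (g_continuous k)
  refine isWeakGradient_of_tendsto hU.measurableSet
    (locallyIntegrableOn_primitive_comp hu.1 hfi) hfG.locallyIntegrableOn
    fun K hK hKU => ⟨fun k x => primitive (g k) (u x), fun k x => g k (u x) • G x, fun k =>
      ⟨h.primitive_comp_of_continuous hU hu hG (g_continuous k) (hB k),
        (integrableOn_primitive_comp hu (g_continuous k).measurable (hB k)).mono_set hKU,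
        IntegrableOn.mono_set (hG.bdd_smul (B k) ((g_continuous k).comp_aestronglyMeasurable hu.1)
          (Eventually.of_forall fun x => hB k (u x))) hKU⟩, ?_, ?_⟩
  · refine tendsto_of_tendsto_of_tendsto_of_le_of_le tendsto_const_nhds
      (by
        simpa using ENNReal.Tendsto.mul_const mass_tendsto
          (Or.inr (hK.measure_lt_top (μ := volume)).ne))
      (fun _ => zero_le) fun k => ?_
    refine (lintegral_mono fun x => (enorm_primitive_sub_primitive_le
      ((g_continuous k).integrable_of_hasCompactSupport (g_compact k)) hfi (u x)).trans
        (g_close k)).trans_eq ?_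
    rw [setLIntegral_const]
  · exact tendsto_of_tendsto_of_tendsto_of_le_of_le tendsto_const_nhds mass_tendsto
      (fun _ => zero_le) fun k => (lintegral_mono_set hKU).trans (g_smul_close k)

end ChainRule

section Sobolev

variable {n : ℕ} {U : Set (E n)}

theorem H1.isWeakGradient (u : H1 U) : IsWeakGradient U u.fn u.grad := u.2

theorem H1.exists_of_isWeakGradient {u : E n → ℝ} {G : E n → E n}
    (hu : MemLp u 2 (volume.restrict U)) (hG : MemLp G 2 (volume.restrict U))
    (h : IsWeakGradient U u G) :
    ∃ w : H1 U, w.fn =ᵐ[volume.restrict U] u ∧ w.grad =ᵐ[volume.restrict U] G := by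
  refine ⟨⟨WithLp.toLp 2 (hu.toLp, hG.toLp), fun φ hφ => ?_⟩, hu.coeFn_toLp, hG.coeFn_toLp⟩
  calc ∫ x in U, hu.toLp u x • gradient φ x = ∫ x in U, u x • gradient φ x :=
        integral_congr_ae (hu.coeFn_toLp.smul .rfl)
    _ = -∫ x in U, φ x • G x := h φ hφ
    _ = -∫ x in U, φ x • hG.toLp G x :=
        congrArg Neg.neg (integral_congr_ae (EventuallyEq.smul .rfl hG.coeFn_toLp)).symm

theorem H1.norm_sq (u : H1 U) : ‖u‖ ^ 2 = ‖u.fn‖ ^ 2 + ‖u.grad‖ ^ 2 :=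
  WithLp.prod_norm_sq_eq_of_L2 (u : WithLp 2 (L2 U × L2Vec U))

/-- `w = F ∘ u` for the primitive `F` of `f`, with the gradient given by the chain rule. -/
structure H1.IsPrimitiveComp (f : ℝ → ℝ) (u w : H1 U) : Prop where
  fn_eq : w.fn =ᵐ[volume.restrict U] fun x => primitive f (u.fn x)
  grad_eq : w.grad =ᵐ[volume.restrict U] fun x => f (u.fn x) • u.grad x

variable {f : ℝ → ℝ} {B : ℝ} (hf : Measurable f) (hB : ∀ s, |f s| ≤ B)

include hf hB

theorem H1.exists_isPrimitiveComp (hU : IsOpen U) (hfin : volume U ≠ ⊤) (hfi : Integrable f)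
    (u : H1 U) : ∃ w, H1.IsPrimitiveComp f u w := by
  have : IsFiniteMeasure (volume.restrict U) := isFiniteMeasure_restrict.2 hfin
  have fn_memLp := Lp.memLp u.fn
  have smul_memLp : MemLp (fun x => f (u.fn x) • u.grad x) 2 (volume.restrict U) :=
    (Lp.memLp u.grad).of_le_mul (c := B)
      ((hf.comp_aemeasurable fn_memLp.1.aemeasurable).aestronglyMeasurable.smul
        (Lp.memLp u.grad).1) (Eventually.of_forall fun x => by
          rw [norm_smul]
          gcongr
          exact hB _)
  have primitive_memLp : MemLp (fun x => primitive f (u.fn x)) 2 (volume.restrict U) :=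
    fn_memLp.of_le_mul ((continuous_primitive hf hB).comp_aestronglyMeasurable fn_memLp.1)
      (Eventually.of_forall fun x => abs_primitive_le hf hB _)
  obtain ⟨w, hw⟩ := H1.exists_of_isWeakGradient primitive_memLp smul_memLp
    (u.isWeakGradient.primitive_comp hU (fn_memLp.integrable one_le_two)
      ((Lp.memLp u.grad).integrable one_le_two) hf hfi (smul_memLp.integrable one_le_two))
  exact ⟨w, hw.1, hw.2⟩

theorem H1.IsPrimitiveComp.norm_le {u w : H1 U} (h : H1.IsPrimitiveComp f u w) :
    ‖w‖ ≤ B * ‖u‖ := by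
  have fn_norm_le : ‖w.fn‖ ≤ B * ‖u.fn‖ := by
    refine Lp.norm_le_mul_norm_of_ae_le_mul ?_
    filter_upwards [h.fn_eq] with x hx
    rw [hx]
    exact abs_primitive_le hf hB _
  have grad_norm_le : ‖w.grad‖ ≤ B * ‖u.grad‖ := by
    refine Lp.norm_le_mul_norm_of_ae_le_mul ?_
    filter_upwards [h.grad_eq] with x hx
    rw [hx, norm_smul]
    gcongr
    exact hB _
  have B_nonneg : 0 ≤ B := (abs_nonneg _).trans (hB 0)
  refine (abs_le_of_sq_le_sq' ?_ (by positivity)).2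
  rw [H1.norm_sq w, mul_pow, H1.norm_sq u, mul_add, ← mul_pow, ← mul_pow]
  gcongr

end Sobolev

section WeakTimeDerivative

section Cutoff

variable {a b : ℝ}

theorem normed_eq_zero_of_rOut_le (φ : ContDiffBump (0 : ℝ)) {r : ℝ} (hr : φ.rOut ≤ |r|) :
    φ.normed volume r = 0 := by
  refine Function.notMem_support.1 fun h => ?_
  rw [φ.support_normed_eq, mem_ball_zero_iff] at h
  exact hr.not_gt h

/-- A smooth cutoff in time: the indicator of `(a, b]`, mollified. -/
def smoothIndicator (φ : ContDiffBump (0 : ℝ)) (a b : ℝ) : ℝ → ℝ :=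
  mollify volume φ ((Ioc a b).indicator 1)

theorem smoothIndicator_eq_integral (φ : ContDiffBump (0 : ℝ)) (hab : a ≤ b) (s : ℝ) :
    smoothIndicator φ a b s = ∫ r in (s - b)..(s - a), φ.normed volume r := by
  rw [← intervalIntegral.integral_comp_sub_left, intervalIntegral.integral_of_le hab,
    ← integral_indicator measurableSet_Ioc, smoothIndicator, mollify, convolution_eq_swap]
  refine integral_congr_ae (Eventually.of_forall fun y => ?_)
  by_cases hy : y ∈ Ioc a b <;> simp [hy]

theorem hasDerivAt_smoothIndicator (φ : ContDiffBump (0 : ℝ)) (hab : a ≤ b) (s : ℝ) :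
    HasDerivAt (smoothIndicator φ a b)
      (φ.normed volume (s - a) - φ.normed volume (s - b)) s := by
  have normed_continuous : Continuous (φ.normed volume) := φ.continuous_normed
  have split : smoothIndicator φ a b =
      fun s => primitive (φ.normed volume) (s - a) - primitive (φ.normed volume) (s - b) := by
    funext s
    rw [smoothIndicator_eq_integral φ hab]
    exact (intervalIntegral.integral_interval_sub_left (normed_continuous.intervalIntegrable _ _)
      (normed_continuous.intervalIntegrable _ _)).symm
  rw [split]
  exact ((hasDerivAt_primitive normed_continuous (s - a)).comp_sub_const s a).sub
    ((hasDerivAt_primitive normed_continuous (s - b)).comp_sub_const s b)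

theorem contDiff_smoothIndicator (φ : ContDiffBump (0 : ℝ)) (a b : ℝ) :
    ContDiff ℝ ∞ (smoothIndicator φ a b) :=
  φ.hasCompactSupport_normed.contDiff_convolution_left _ φ.contDiff_normed
    ((integrable_indicator_iff measurableSet_Ioc).2
      (integrableOn_const measure_Ioc_lt_top.ne)).locallyIntegrable

theorem tsupport_smoothIndicator_subset (φ : ContDiffBump (0 : ℝ)) (hab : a ≤ b) :
    tsupport (smoothIndicator φ a b) ⊆ Icc (a - φ.rOut) (b + φ.rOut) := by
  refine closure_minimal (Function.support_subset_iff'.2 fun s hs => ?_) isClosed_Icc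
  rw [smoothIndicator_eq_integral φ hab]
  refine intervalIntegral.integral_zero_ae (Eventually.of_forall fun r hr =>
    normed_eq_zero_of_rOut_le φ ?_)
  rw [uIoc_of_le (by linarith)] at hr
  rw [mem_Icc, not_and_or, not_le, not_le] at hs
  rcases hs with hs | hs
  · exact (by linarith [hr.2] : φ.rOut ≤ -r).trans (neg_le_abs r)
  · exact (by linarith [hr.1] : φ.rOut ≤ r).trans (le_abs_self r)

theorem norm_smoothIndicator_le (φ : ContDiffBump (0 : ℝ)) (hab : a ≤ b) (s : ℝ) :
    ‖smoothIndicator φ a b s‖ ≤ 1 := by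
  have normed_nonneg : ∀ r, 0 ≤ φ.normed volume r := φ.nonneg_normed
  rw [smoothIndicator_eq_integral φ hab, intervalIntegral.integral_of_le (by linarith),
    Real.norm_of_nonneg (setIntegral_nonneg measurableSet_Ioc fun r _ => normed_nonneg r)]
  exact (setIntegral_le_integral φ.integrable_normed (Eventually.of_forall normed_nonneg)).trans_eq
    φ.integral_normed

theorem tendsto_integral_smoothIndicator_mul {φ : ℕ → ContDiffBump (0 : ℝ)}
    (hφ : Tendsto (fun i => (φ i).rOut) atTop (𝓝 0)) (hφ' : ∀ i, (φ i).rOut ≤ 2 * (φ i).rIn)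
    {S T : ℝ} {k : ℝ → ℝ} (hk : IntegrableOn k (Ioo S T)) (ha : S < a) (hab : a ≤ b)
    (hb : b < T) :
    Tendsto (fun i => ∫ t in Ioo S T, smoothIndicator (φ i) a b t * k t) atTop
      (𝓝 (∫ t in a..b, k t)) := by
  have limit_eq : ∫ t in a..b, k t = ∫ t in Ioo S T, (Ioc a b).indicator (1 : ℝ → ℝ) t * k t := by
    have indicator_mul_eq :
        (fun t => (Ioc a b).indicator (1 : ℝ → ℝ) t * k t) = (Ioc a b).indicator k := by
      funext t
      by_cases ht : t ∈ Ioc a b <;> simp [ht]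
    have Ioc_subset : Ioc a b ⊆ Ioo S T := fun t ht => ⟨ha.trans ht.1, ht.2.trans_lt hb⟩
    rw [indicator_mul_eq, setIntegral_indicator measurableSet_Ioc,
      inter_eq_self_of_subset_right Ioc_subset, intervalIntegral.integral_of_le hab]
  have indicator_integrable : Integrable ((Ioc a b).indicator (1 : ℝ → ℝ)) :=
    (integrable_indicator_iff measurableSet_Ioc).2 (integrableOn_const measure_Ioc_lt_top.ne)
  rw [limit_eq]
  refine tendsto_integral_of_dominated_convergence (fun t => ‖k t‖) (fun i =>
    (contDiff_smoothIndicator (φ i) a b).continuous.aestronglyMeasurable.mul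
      hk.aestronglyMeasurable) hk.norm (fun i => Eventually.of_forall fun t => ?_) ?_
  · rw [norm_mul]
    exact mul_le_of_le_one_left (norm_nonneg _) (norm_smoothIndicator_le (φ i) hab t)
  · filter_upwards [ae_restrict_of_ae
      (ContDiffBump.ae_convolution_tendsto_right_of_locallyIntegrable hφ
        (Eventually.of_forall hφ') indicator_integrable.locallyIntegrable)] with t ht
    exact ht.mul_const _

end Cutoff

section WeakDerivative

variable {S T : ℝ} {f k : ℝ → ℝ}

theorem tendsto_mollify_of_continuousOn {φ : ℕ → ContDiffBump (0 : ℝ)}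
    (hφ : Tendsto (fun i => (φ i).rOut) atTop (𝓝 0)) (hf : ContinuousOn f (Icc S T)) {c : ℝ}
    (hc : c ∈ Ioo S T) :
    Tendsto (fun i => mollify volume (φ i) ((Ioo S T).indicator f) c) atTop (𝓝 (f c)) := by
  have indicator_integrable : Integrable ((Ioo S T).indicator f) :=
    (integrable_indicator_iff measurableSet_Ioo).2
      (hf.integrableOn_Icc.mono_set Ioo_subset_Icc_self)
  have indicator_continuousAt : ContinuousAt ((Ioo S T).indicator f) c :=
    (hf.continuousAt (Icc_mem_nhds hc.1 hc.2)).congr <| by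
      filter_upwards [isOpen_Ioo.mem_nhds hc] with t ht
      exact (indicator_of_mem ht f).symm
  rw [← indicator_of_mem hc f]
  exact ContDiffBump.convolution_tendsto_right hφ
    (Eventually.of_forall fun _ => indicator_integrable.aestronglyMeasurable)
    (indicator_continuousAt.tendsto.comp tendsto_snd) tendsto_const_nhds

theorem integral_deriv_smoothIndicator_mul (hf : IntegrableOn f (Ioo S T))
    (φ : ContDiffBump (0 : ℝ)) {a b : ℝ} (hab : a ≤ b) :
    ∫ t in Ioo S T, deriv (smoothIndicator φ a b) t * f t =
      mollify volume φ ((Ioo S T).indicator f) a - mollify volume φ ((Ioo S T).indicator f) b := by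
  have mollify_eq : ∀ c, mollify volume φ ((Ioo S T).indicator f) c =
      ∫ t in Ioo S T, φ.normed volume (t - c) * f t := fun c => by
    rw [mollify, convolution_eq_swap, ← integral_indicator measurableSet_Ioo]
    refine integral_congr_ae (Eventually.of_forall fun t => ?_)
    by_cases ht : t ∈ Ioo S T
    · simp [ht, ← φ.normed_neg (c - t)]
    · simp [ht]
  have integrable_mul : ∀ c, IntegrableOn (fun t => φ.normed volume (t - c) * f t) (Ioo S T) := by
    obtain ⟨K, hK⟩ := φ.continuous_normed.bounded_above_of_compact_support
      (φ.hasCompactSupport_normed (μ := volume))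
    exact fun c => hf.bdd_mul
      (φ.continuous_normed.comp (continuous_sub_right c)).aestronglyMeasurable
      (Eventually.of_forall fun t => hK (t - c))
  rw [mollify_eq, mollify_eq, ← integral_sub (integrable_mul a) (integrable_mul b)]
  simp only [(hasDerivAt_smoothIndicator φ hab _).deriv, sub_mul]

/-- The weak derivative is tested with mollified indicators of `(a, b]`. -/
theorem sub_eq_integral_of_weakDeriv (hf : ContinuousOn f (Icc S T)) (hk : IntegrableOn k (Ioo S T))
    (h : ∀ η : ℝ → ℝ, ContDiff ℝ ∞ η → HasCompactSupport η → tsupport η ⊆ Ioo S T →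
      ∫ t in Ioo S T, deriv η t * f t = -∫ t in Ioo S T, η t * k t)
    {a b : ℝ} (ha : S < a) (hab : a ≤ b) (hb : b < T) : f b - f a = ∫ t in a..b, k t := by
  obtain ⟨δ, δ_pos, hδ⟩ := exists_between (lt_min (sub_pos.2 ha) (sub_pos.2 hb))
  rw [lt_min_iff] at hδ
  obtain ⟨φ, rOut_le, rOut_le_rIn, rOut_tendsto⟩ := exists_seq_contDiffBump (V := ℝ) δ_pos
  have tsupport_subset : ∀ i,
      tsupport (smoothIndicator (φ i) a b) ⊆ Ioo S T := fun i s hs => by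
    have hs := tsupport_smoothIndicator_subset (φ i) hab hs
    exact ⟨by linarith [hs.1, rOut_le i, hδ.1], by linarith [hs.2, rOut_le i, hδ.2]⟩
  have tested : ∀ i, mollify volume (φ i) ((Ioo S T).indicator f) a -
      mollify volume (φ i) ((Ioo S T).indicator f) b =
      -∫ t in Ioo S T, smoothIndicator (φ i) a b t * k t := fun i => by
    rw [← integral_deriv_smoothIndicator_mul
      (hf.integrableOn_Icc.mono_set Ioo_subset_Icc_self) (φ i) hab]
    exact h _ (contDiff_smoothIndicator (φ i) a b) (isCompact_Icc.of_isClosed_subset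
      (isClosed_tsupport _) (tsupport_smoothIndicator_subset (φ i) hab)) (tsupport_subset i)
  have left_tendsto := (tendsto_mollify_of_continuousOn rOut_tendsto hf
    ⟨ha, hab.trans_lt hb⟩).sub (tendsto_mollify_of_continuousOn rOut_tendsto hf
      ⟨ha.trans_le hab, hb⟩)
  have right_tendsto := (tendsto_integral_smoothIndicator_mul rOut_tendsto rOut_le_rIn hk ha
    hab hb).neg
  linarith [tendsto_nhds_unique (left_tendsto.congr tested) right_tendsto]

end WeakDerivative

end WeakTimeDerivative

section EnergyInequality

theorem eventually_le_integral_increment {e : ℝ → ℝ} (he : Continuous e) {t₀ d : ℝ}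
    (hd : d < e t₀ - e 0) :
    ∀ᶠ τ in 𝓝[>] (0 : ℝ), τ * d ≤ ∫ t in τ..t₀, (e t - e (t - τ)) := by
  have integral_eq : ∀ τ, ∫ t in τ..t₀, (e t - e (t - τ)) =
      primitive e t₀ - primitive e τ - primitive e (t₀ - τ) := fun τ => by
    rw [intervalIntegral.integral_sub (he.intervalIntegrable _ _)
      (Continuous.intervalIntegrable (by fun_prop) _ _),
      intervalIntegral.integral_comp_sub_right e τ, sub_self, primitive, primitive, primitive,
      intervalIntegral.integral_interval_sub_left (he.intervalIntegrable _ _)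
        (he.intervalIntegrable _ _)]
  have has_deriv : HasDerivAt
      (fun τ => primitive e t₀ - primitive e τ - primitive e (t₀ - τ)) (e t₀ - e 0) 0 := by
    have h := ((hasDerivAt_primitive he 0).const_sub (primitive e t₀)).sub
      ((hasDerivAt_primitive he (t₀ - 0)).comp_const_sub t₀ 0)
    exact h.congr_deriv (by rw [sub_zero]; ring)
  filter_upwards [has_deriv.tendsto_slope_zero_right.eventually_const_lt hd,
    self_mem_nhdsWithin] with τ slope_gt τ_pos
  rw [integral_eq]
  simp only [zero_add, primitive_zero, sub_zero, sub_self, smul_eq_mul] at slope_gt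
  rw [← div_eq_inv_mul, lt_div_iff₀ τ_pos] at slope_gt
  linarith

variable {X : Type*} [NormedAddCommGroup X] [NormedSpace ℝ X] {T : ℝ}

theorem ofReal_integral_apply_sub_le {g : ℝ → StrongDual ℝ X} (hg : LocallyIntegrable g)
    {t τ : ℝ} (hτ : 0 ≤ τ) (ψ : X) :
    ENNReal.ofReal ((∫ r in (t - τ)..t, g r ψ) - τ * g t ψ) ≤
      ‖ψ‖ₑ * ∫⁻ θ in Ioo 0 τ, ‖g (t - θ) - g t‖ₑ := by
  have apply_integrable : IntervalIntegrable (fun r => g r ψ) volume (t - τ) t :=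
    IntegrableOn.intervalIntegrable
      ((hg.integrableOn_isCompact isCompact_uIcc).apply_continuousLinearMap ψ)
  have integral_eq : (∫ r in (t - τ)..t, g r ψ) - τ * g t ψ =
      ∫ θ in (0 : ℝ)..τ, (g (t - θ) - g t) ψ := by
    rw [intervalIntegral.integral_comp_sub_left (fun r => (g r - g t) ψ), sub_zero]
    simp only [sub_apply]
    rw [intervalIntegral.integral_sub apply_integrable intervalIntegrable_const,
      intervalIntegral.integral_const, sub_sub_cancel, smul_eq_mul]
  rw [integral_eq, intervalIntegral.integral_of_le hτ, integral_Ioc_eq_integral_Ioo,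
    ← lintegral_const_mul' _ _ enorm_ne_top]
  refine (Real.ofReal_le_enorm _).trans ((enorm_integral_le_lintegral_enorm _).trans
    (lintegral_mono fun θ => ?_))
  rw [mul_comm]
  exact (g (t - θ) - g t).le_opENorm ψ

theorem integral_le_toReal_lintegral {α : Type*} [MeasurableSpace α] {μ : Measure α} {f : α → ℝ}
    (hf : Integrable f μ) : ∫ x, f x ∂μ ≤ (∫⁻ x, ENNReal.ofReal (f x) ∂μ).toReal := by
  rw [integral_eq_lintegral_pos_part_sub_lintegral_neg_part hf]
  exact sub_le_self _ ENNReal.toReal_nonneg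

theorem eventually_lintegral_mul_backward_average_le {g : ℝ → StrongDual ℝ X} {b : ℝ → ℝ}
    (hg : MemLp g 2) (hb : MemLp b 2) {η : ℝ} (hη : 0 < η) :
    ∀ᶠ τ in 𝓝[>] (0 : ℝ), ∫⁻ t, ‖b t‖ₑ * ∫⁻ θ in Ioo 0 τ, ‖g (t - θ) - g t‖ₑ ≤
      ENNReal.ofReal (η * τ) := by
  filter_upwards [eventually_lintegral_mul_translate_sub_le ENNReal.ofNat_ne_top hg hb
    (ENNReal.ofReal_pos.2 hη)] with τ hτ
  have support_subset : Function.support ((Ioo 0 τ).indicator (1 : ℝ → ℝ≥0∞)) ⊆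
      Metric.ball 0 τ := fun θ hθ => by
    have hθ := mem_of_indicator_ne_zero hθ
    rw [mem_ball_zero_iff, Real.norm_of_nonneg hθ.1.le]
    exact hθ.2
  have indicator_mul : ∀ f : ℝ → ℝ≥0∞,
      ∫⁻ θ, (Ioo 0 τ).indicator (1 : ℝ → ℝ≥0∞) θ * f θ = ∫⁻ θ in Ioo 0 τ, f θ := fun f => by
    rw [← lintegral_indicator measurableSet_Ioo]
    refine lintegral_congr fun θ => ?_
    by_cases hθ : θ ∈ Ioo 0 τ <;> simp [hθ]
  have averaged := hτ _ (measurable_one.indicator measurableSet_Ioo) support_subset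
  simp only [indicator_mul, lintegral_indicator_one measurableSet_Ioo, Real.volume_Ioo,
    sub_zero] at averaged
  rwa [ENNReal.ofReal_mul hη.le]

/-- The increment of `e` over `(t - τ, t)` is tested with the direction `ψ` belonging to the time
`t`. Replacing `g r` by `g t` in it costs a translation error of `g` in `L²`, which is `o(τ)` after
integration over `t`; so no differentiability of `e` is needed. -/
theorem integral_increment_le {e : ℝ → ℝ} (he : Continuous e) {g : ℝ → StrongDual ℝ X}
    {b : ℝ → ℝ} (hg : LocallyIntegrable g) {τ t₀ η : ℝ} (hτ : 0 < τ) (hτt₀ : τ ≤ t₀) (hη : 0 ≤ η)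
    (average_le : ∫⁻ t, ‖b t‖ₑ * ∫⁻ θ in Ioo 0 τ, ‖g (t - θ) - g t‖ₑ ≤ ENNReal.ofReal η)
    (h : ∀ᵐ t ∂volume.restrict (Ioo τ t₀), ∃ ψ : X, ‖ψ‖ ≤ b t ∧ g t ψ ≤ 0 ∧
      e t - e (t - τ) ≤ ∫ r in (t - τ)..t, g r ψ) :
    ∫ t in τ..t₀, (e t - e (t - τ)) ≤ η := by
  have increment_le : ∀ᵐ t ∂volume.restrict (Ioo τ t₀), ENNReal.ofReal (e t - e (t - τ)) ≤
      ‖b t‖ₑ * ∫⁻ θ in Ioo 0 τ, ‖g (t - θ) - g t‖ₑ := by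
    filter_upwards [h] with t ⟨ψ, ψ_le, apply_nonpos, increment_le⟩
    calc ENNReal.ofReal (e t - e (t - τ))
        ≤ ENNReal.ofReal ((∫ r in (t - τ)..t, g r ψ) - τ * g t ψ) :=
          ENNReal.ofReal_le_ofReal (by nlinarith)
      _ ≤ ‖ψ‖ₑ * ∫⁻ θ in Ioo 0 τ, ‖g (t - θ) - g t‖ₑ := ofReal_integral_apply_sub_le hg hτ.le ψ
      _ ≤ ‖b t‖ₑ * ∫⁻ θ in Ioo 0 τ, ‖g (t - θ) - g t‖ₑ := by
          gcongr
          exact enorm_le_iff_norm_le.2 (ψ_le.trans (le_abs_self _))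
  rw [intervalIntegral.integral_of_le hτt₀, integral_Ioc_eq_integral_Ioo]
  refine (integral_le_toReal_lintegral ?_).trans (ENNReal.toReal_le_of_le_ofReal hη
    ((lintegral_mono_ae increment_le).trans ((setLIntegral_le_lintegral _ _).trans average_le)))
  exact (Continuous.integrableOn_Icc (by fun_prop)).mono_set Ioo_subset_Icc_self

theorem memLp_indicator_of_memLp_timeMeasure {Y : Type*} [NormedAddCommGroup Y] {w : ℝ → Y}
    {p : ℝ≥0∞} (hw : MemLp w p (timeMeasure T)) : MemLp ((Ioo 0 T).indicator w) p := by
  rw [timeMeasure] at hw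
  rwa [memLp_indicator_iff_restrict measurableSet_Ioo]

variable {g : ℝ → StrongDual ℝ X} {b : ℝ → ℝ} (hg : MemLp g 2 (timeMeasure T))
  (hb : MemLp b 2 (timeMeasure T))

include hg hb

theorem le_initial_of_increment_le_of_continuous {e : ℝ → ℝ} (he : Continuous e)
    (h : ∀ᵐ t ∂timeMeasure T, ∃ ψ : X, ‖ψ‖ ≤ b t ∧ g t ψ ≤ 0 ∧
      ∀ s ∈ Ioo 0 t, e t - e s ≤ ∫ r in s..t, g r ψ)
    {t₀ : ℝ} (ht₀ : t₀ ∈ Icc 0 T) : e t₀ ≤ e 0 := by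
  by_contra! hlt
  have t₀_pos : 0 < t₀ := ht₀.1.lt_of_ne (by rintro rfl; exact hlt.false)
  obtain ⟨d, d_pos, hd⟩ := exists_between (sub_pos.2 hlt)
  have g_extend := memLp_indicator_of_memLp_timeMeasure hg
  have b_extend := memLp_indicator_of_memLp_timeMeasure hb
  obtain ⟨τ, ⟨average_le, le_increment⟩, τ_pos, τ_lt⟩ :=
    (((eventually_lintegral_mul_backward_average_le g_extend b_extend (half_pos d_pos)).and
      (eventually_le_integral_increment he hd)).and (Ioo_mem_nhdsGT t₀_pos)).exists
  have subset : Ioo τ t₀ ⊆ Ioo 0 T := Ioo_subset_Ioo τ_pos.le ht₀.2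
  have pointwise : ∀ᵐ t ∂volume.restrict (Ioo τ t₀), ∃ ψ : X, ‖ψ‖ ≤ (Ioo 0 T).indicator b t ∧
      (Ioo 0 T).indicator g t ψ ≤ 0 ∧
      e t - e (t - τ) ≤ ∫ r in (t - τ)..t, (Ioo 0 T).indicator g r ψ := by
    filter_upwards [ae_restrict_of_ae_restrict_of_subset subset h,
      ae_restrict_mem measurableSet_Ioo] with t ⟨ψ, ψ_le, apply_nonpos, increment_le⟩ ht
    have past_subset : uIcc (t - τ) t ⊆ Ioo 0 T := by
      rw [uIcc_of_le (by linarith)]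
      exact fun r hr => ⟨by linarith [hr.1, ht.1], hr.2.trans_lt (subset ht).2⟩
    rw [indicator_of_mem (subset ht), indicator_of_mem (subset ht)]
    refine ⟨ψ, ψ_le, apply_nonpos, (increment_le (t - τ) ⟨sub_pos.2 ht.1, by linarith⟩).trans_eq
      (intervalIntegral.integral_congr fun r hr => ?_)⟩
    simp only [indicator_of_mem (past_subset hr)]
  have increment_le := integral_increment_le he (g_extend.locallyIntegrable one_le_two) τ_pos
    τ_lt.le (by positivity) average_le pointwise
  nlinarith

theorem le_initial_of_increment_le {e : ℝ → ℝ} (he : ContinuousOn e (Icc 0 T))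
    (h : ∀ᵐ t ∂timeMeasure T, ∃ ψ : X, ‖ψ‖ ≤ b t ∧ g t ψ ≤ 0 ∧
      ∀ s ∈ Ioo 0 t, e t - e s ≤ ∫ r in s..t, g r ψ)
    {t₀ : ℝ} (ht₀ : t₀ ∈ Icc 0 T) : e t₀ ≤ e 0 := by
  have T_nonneg : 0 ≤ T := ht₀.1.trans ht₀.2
  have extend_eq : ∀ t ∈ Icc 0 T, IccExtend T_nonneg ((Icc 0 T).domRestrict e) t = e t :=
    fun t ht => IccExtend_of_mem T_nonneg _ ht
  rw [← extend_eq t₀ ht₀, ← extend_eq 0 ⟨le_rfl, T_nonneg⟩]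
  refine le_initial_of_increment_le_of_continuous hg hb he.domRestrict.Icc_extend' ?_ ht₀
  filter_upwards [h, ae_restrict_mem measurableSet_Ioo] with t ⟨ψ, ψ_le, apply_nonpos, hψ⟩ ht
  refine ⟨ψ, ψ_le, apply_nonpos, fun s hs => ?_⟩
  rw [extend_eq t (Ioo_subset_Icc_self ht), extend_eq s ⟨hs.1.le, hs.2.le.trans ht.2.le⟩]
  exact hψ s hs

end EnergyInequality

section Ramp

/-- The indicator of `(L, L + 1]`, the derivative of `ramp L`. -/
def window (L : ℝ) : ℝ → ℝ := (Ioc L (L + 1)).indicator 1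

/-- The truncated positive part `min (s - L)₊ 1`. Truncation keeps `s * window L s` bounded. -/
def ramp (L s : ℝ) : ℝ := max 0 (min (s - L) 1)

theorem window_nonneg (L s : ℝ) : 0 ≤ window L s :=
  indicator_nonneg (fun _ _ => zero_le_one) s

theorem abs_window_le (L s : ℝ) : |window L s| ≤ 1 := by
  rw [abs_of_nonneg (window_nonneg L s)]
  exact indicator_le_self' (fun _ _ => zero_le_one) s

theorem measurable_window (L : ℝ) : Measurable (window L) :=
  measurable_one.indicator measurableSet_Ioc

theorem ramp_nonneg (L s : ℝ) : 0 ≤ ramp L s := le_max_left _ _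

theorem abs_ramp_le (L s : ℝ) : |ramp L s| ≤ 1 := by
  rw [abs_of_nonneg (ramp_nonneg L s)]
  exact max_le zero_le_one (min_le_right _ _)

theorem ramp_mono (L : ℝ) : Monotone (ramp L) := fun a b h => by
  unfold ramp
  gcongr

theorem continuous_ramp (L : ℝ) : Continuous (ramp L) := by
  unfold ramp
  fun_prop

theorem ramp_of_le {L s : ℝ} (h : s ≤ L) : ramp L s = 0 := by
  rw [ramp, min_eq_left (by linarith), max_eq_left (by linarith)]

theorem integrable_window (L : ℝ) : Integrable (window L) :=
  (integrable_indicator_iff measurableSet_Ioc).2 (integrableOn_const measure_Ioc_lt_top.ne)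

theorem primitive_window {L : ℝ} (hL : 0 ≤ L) (s : ℝ) : primitive (window L) s = ramp L s := by
  have integral_window : ∀ a b, ∫ r in Ioc a b, window L r =
      max (min b (L + 1) - max a L) 0 := fun a b => by
    rw [window, setIntegral_indicator measurableSet_Ioc, Ioc_inter_Ioc]
    simp only [Pi.one_apply, integral_const, smul_eq_mul, mul_one, measureReal_restrict_apply_univ,
      Real.volume_real_Ioc]
  rcases le_total 0 s with hs | hs
  · rw [primitive, intervalIntegral.integral_of_le hs, integral_window, max_eq_right hL, ramp,
      max_comm, ← min_sub_sub_right, add_sub_cancel_left]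
  · have empty_overlap : min 0 (L + 1) - L ≤ 0 := by linarith [min_le_left 0 (L + 1)]
    rw [primitive, intervalIntegral.integral_of_ge hs, integral_window, max_eq_right (hs.trans hL),
      max_eq_right empty_overlap, ramp_of_le (hs.trans hL), neg_zero]

theorem ramp_pos {L s : ℝ} (h : L < s) : 0 < ramp L s :=
  lt_max_of_lt_right (lt_min (sub_pos.2 h) one_pos)

/-- A convex primitive of `ramp L`. -/
def rampEnergy (L : ℝ) : ℝ → ℝ := primitive (ramp L)

theorem rampEnergy_sub_le (L a b : ℝ) :
    rampEnergy L b - rampEnergy L a ≤ ramp L b * (b - a) := by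
  have ramp_integrable : ∀ a b, IntervalIntegrable (ramp L) volume a b :=
    (continuous_ramp L).intervalIntegrable
  rw [rampEnergy, primitive_sub (continuous_ramp L).measurable (abs_ramp_le L)]
  rcases le_total a b with hab | hba
  · have := intervalIntegral.integral_mono_on hab (ramp_integrable a b)
      (intervalIntegrable_const (c := ramp L b)) fun r hr => ramp_mono L hr.2
    rwa [intervalIntegral.integral_const, smul_eq_mul, mul_comm] at this
  · have := intervalIntegral.integral_mono_on hba (intervalIntegrable_const (c := ramp L b))
      (ramp_integrable b a) fun r hr => ramp_mono L hr.1
    rw [intervalIntegral.integral_const, smul_eq_mul] at this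
    rw [intervalIntegral.integral_symm]
    linarith

theorem rampEnergy_of_le {L s : ℝ} (hL : 0 ≤ L) (hs : s ≤ L) : rampEnergy L s = 0 := by
  have energy_zero : rampEnergy L 0 = 0 := primitive_zero _
  have le_zero := rampEnergy_sub_le L 0 s
  have zero_le := rampEnergy_sub_le L s 0
  rw [ramp_of_le hs] at le_zero
  rw [ramp_of_le hL] at zero_le
  linarith

theorem rampEnergy_nonneg {L : ℝ} (hL : 0 ≤ L) (s : ℝ) : 0 ≤ rampEnergy L s := by
  have h := rampEnergy_sub_le L s L
  rw [ramp_of_le le_rfl, rampEnergy_of_le hL le_rfl] at h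
  linarith

theorem rampEnergy_pos {L s : ℝ} (hL : 0 ≤ L) (hs : L < s) : 0 < rampEnergy L s := by
  obtain ⟨r, hLr, hrs⟩ := exists_between hs
  have h := rampEnergy_sub_le L s r
  have r_nonneg := rampEnergy_nonneg hL r
  have := mul_pos (ramp_pos hLr) (sub_pos.2 hrs)
  linarith

theorem lipschitzWith_rampEnergy (L : ℝ) : LipschitzWith 1 (rampEnergy L) :=
  LipschitzWith.of_dist_le_mul fun a b => by
    simpa only [Real.dist_eq, rampEnergy, NNReal.coe_one] using
      abs_primitive_sub_le (continuous_ramp L).measurable (abs_ramp_le L) b a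

end Ramp

section Energy

variable {n : ℕ} {U : Set (E n)}

/-- A convex functional on `L²(U)` whose zeros are the functions with `w ≤ L`. -/
def energy (L : ℝ) (w : L2 U) : ℝ := ∫ x in U, rampEnergy L (w x)

variable [IsFiniteMeasure ((volume : Measure (E n)).restrict U)]

theorem continuous_energy (L : ℝ) : Continuous (energy (U := U) L) := by
  have rampEnergy_zero : rampEnergy L 0 = 0 := primitive_zero _
  have energy_eq_inner : energy (U := U) L = fun w =>
      ⟪Lp.const 2 (volume.restrict U) (1 : ℝ),
        (lipschitzWith_rampEnergy L).compLp rampEnergy_zero w⟫ := by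
    funext w
    rw [energy, L2.inner_def]
    refine integral_congr_ae ?_
    filter_upwards [(lipschitzWith_rampEnergy L).coeFn_compLp rampEnergy_zero w,
      Lp.coeFn_const 2 (volume.restrict U) (1 : ℝ)] with x comp_eq const_eq
    rw [comp_eq, const_eq]
    simp
  rw [energy_eq_inner]
  exact continuous_const.inner ((lipschitzWith_rampEnergy L).continuous_compLp rampEnergy_zero)

theorem integrable_rampEnergy (L : ℝ) (w : L2 U) :
    Integrable (fun x => rampEnergy L (w x)) (volume.restrict U) :=
  (((lipschitzWith_rampEnergy L).comp_memLp (primitive_zero _) (Lp.memLp w)).integrable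
    one_le_two)

theorem energy_eq_zero_iff {L : ℝ} (hL : 0 ≤ L) (w : L2 U) :
    energy L w = 0 ↔ ∀ᵐ x ∂volume.restrict U, w x ≤ L := by
  rw [energy, integral_eq_zero_iff_of_nonneg_ae
    (Eventually.of_forall fun x => rampEnergy_nonneg hL _) (integrable_rampEnergy L w)]
  refine eventually_congr (Eventually.of_forall fun x =>
    ⟨fun h => not_lt.1 fun hlt => (rampEnergy_pos hL hlt).ne' h, rampEnergy_of_le hL⟩)

theorem energy_sub_le (L : ℝ) (w w' : L2 U) {ψ : L2 U}
    (hψ : ψ =ᵐ[volume.restrict U] fun x => ramp L (w x)) :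
    energy L w - energy L w' ≤ ⟪w - w', ψ⟫ := by
  rw [energy, energy, ← integral_sub (integrable_rampEnergy L w) (integrable_rampEnergy L w'),
    L2.inner_def]
  refine integral_mono_ae ((integrable_rampEnergy L w).sub (integrable_rampEnergy L w'))
    (L2.integrable_inner _ _) ?_
  filter_upwards [hψ, Lp.coeFn_sub w w'] with x ψ_eq sub_eq
  rw [ψ_eq, sub_eq]
  exact rampEnergy_sub_le L _ _

end Energy

section Dual

variable {α X : Type*} [MeasurableSpace α] {μ : Measure α} [NormedAddCommGroup X] [NormedSpace ℝ X]

theorem integrable_apply_of_memLp [IsFiniteMeasure μ] {p : ℝ≥0∞} (hp : 1 ≤ p)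
    {g : α → StrongDual ℝ X} (hg : MemLp g p μ) (x : X) : Integrable (fun t => g t x) μ :=
  (hg.integrable hp).apply_continuousLinearMap x

theorem memLp_dual_add {p : ℝ≥0∞} {g₁ g₂ : α → StrongDual ℝ X} (h₁ : MemLp g₁ p μ)
    (h₂ : MemLp g₂ p μ) : MemLp (fun t => g₁ t + g₂ t) p μ :=
  MemLp.add (ε := StrongDual ℝ X) h₁ h₂

theorem memLp_sum_comp {Y ι : Type*} [NormedAddCommGroup Y] [NormedSpace ℝ Y] [Fintype ι]
    {p : ℝ≥0∞} {g : ι → α → StrongDual ℝ X} (hg : ∀ i, MemLp (g i) p μ) (P : ι → Y →L[ℝ] X) :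
    MemLp (fun t => ∑ i, (g i t).comp (P i)) p μ :=
  memLp_finsetSum (ε' := StrongDual ℝ Y) _ fun i _ =>
    ((ContinuousLinearMap.compL ℝ Y X ℝ).flip (P i)).comp_memLp' (hg i)

end Dual

section Comparison

variable {n : ℕ} {U : Set (E n)} {T : ℝ}

/-- `c ∈ L²(0,T;H¹)` has the weak time derivative `g ∈ L²(0,T;(H¹)')` and the continuous
representative `C`. -/
structure IsEvolution (T : ℝ) (c : ℝ → H1 U) (g : ℝ → StrongDual ℝ (H1 U)) (C : ℝ → L2 U) :
    Prop where
  mem : MemLp c 2 (timeMeasure T)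
  deriv_mem : MemLp g 2 (timeMeasure T)
  weakDeriv : IsWeakTimeDeriv T c g
  continuousOn : ContinuousOn C (Icc 0 T)
  ae_eq : ∀ᵐ t ∂timeMeasure T, C t = (c t).fn

theorem isFiniteMeasure_timeMeasure (T : ℝ) : IsFiniteMeasure (timeMeasure T) :=
  isFiniteMeasure_restrict.2 measure_Ioo_lt_top.ne

section Evolution

variable {c : ℝ → H1 U} {g : ℝ → StrongDual ℝ (H1 U)} {C : ℝ → L2 U}

theorem IsEvolution.integrable_apply (h : IsEvolution T c g C) (φ : H1 U) :
    Integrable (fun t => g t φ) (timeMeasure T) :=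
  have := isFiniteMeasure_timeMeasure T
  integrable_apply_of_memLp one_le_two h.deriv_mem φ

theorem IsEvolution.inner_sub (h : IsEvolution T c g C) (φ : H1 U) {s t : ℝ} (hs : 0 < s)
    (hst : s ≤ t) (ht : t < T) : ⟪C t - C s, φ.fn⟫ = ∫ r in s..t, g r φ := by
  rw [inner_sub_left]
  refine sub_eq_integral_of_weakDeriv (f := fun t => ⟪C t, φ.fn⟫)
    (h.continuousOn.inner continuousOn_const) (h.integrable_apply φ)
    (fun η η_smooth η_compact η_supp => ?_) hs hst ht
  refine Eq.trans (integral_congr_ae ?_) (h.weakDeriv φ η η_smooth η_compact η_supp)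
  filter_upwards [h.ae_eq] with r hr
  rw [hr]

theorem IsEvolution.energy_sub_le [IsFiniteMeasure ((volume : Measure (E n)).restrict U)]
    (h : IsEvolution T c g C) {L : ℝ} (hL : 0 ≤ L) {s t : ℝ} (hs : 0 < s) (hst : s ≤ t)
    (ht : t < T) (C_eq : C t = (c t).fn) {φ : H1 U}
    (hφ : H1.IsPrimitiveComp (window L) (c t) φ) :
    energy L (C t) - energy L (C s) ≤ ∫ r in s..t, g r φ := by
  rw [← h.inner_sub φ hs hst ht]
  refine SNPP.energy_sub_le L (C t) (C s) ?_
  filter_upwards [hφ.fn_eq] with x hx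
  rw [hx, primitive_window hL, C_eq]

end Evolution

variable [IsFiniteMeasure ((volume : Measure (E n)).restrict U)] {ι : Type*} [Fintype ι]
  {c : ι → ℝ → H1 U} {g : ι → ℝ → StrongDual ℝ (H1 U)} {C : ι → ℝ → L2 U}

theorem sum_energy_le_initial (hU : IsOpen U) {L : ℝ} (hL : 0 ≤ L)
    (h : ∀ i, IsEvolution T (c i) (g i) (C i))
    (dissipative : ∀ᵐ t ∂timeMeasure T, ∀ φ : ι → H1 U,
      (∀ i, H1.IsPrimitiveComp (window L) (c i t) (φ i)) → ∑ i, g i t (φ i) ≤ 0)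
    {t : ℝ} (ht : t ∈ Icc 0 T) : ∑ i, energy L (C i t) ≤ ∑ i, energy L (C i 0) := by
  have energy_continuous : ContinuousOn (fun t => ∑ i, energy L (C i t)) (Icc 0 T) :=
    continuousOn_finsetSum _ fun i _ =>
      (continuous_energy L).comp_continuousOn (h i).continuousOn
  have norm_memLp : MemLp (fun t => ∑ i, ‖c i t‖) 2 (timeMeasure T) :=
    memLp_finsetSum _ fun i _ => (h i).mem.norm
  have total_memLp := memLp_sum_comp (Y := ι → H1 U) (fun i => (h i).deriv_mem)
    fun i => ContinuousLinearMap.proj i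
  refine le_initial_of_increment_le total_memLp norm_memLp energy_continuous ?_ ht
  filter_upwards [dissipative, ae_all_iff.2 fun i => (h i).ae_eq,
    ae_restrict_mem measurableSet_Ioo] with t dissipative_t C_eq ht
  choose φ hφ using fun i => (c i t).exists_isPrimitiveComp (measurable_window L)
    (abs_window_le L) hU (isFiniteMeasure_restrict.1 inferInstance) (integrable_window L)
  have apply_eq : ∀ r, (∑ i, (g i r).comp (ContinuousLinearMap.proj (φ := fun _ => H1 U) i)) φ =
      ∑ i, g i r (φ i) := fun r => by
    simp only [sum_apply, ContinuousLinearMap.comp_apply,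
      ContinuousLinearMap.proj_apply]
  refine ⟨φ, (pi_norm_le_iff_of_nonneg (by positivity)).2 fun i => ?_,
    (apply_eq t).trans_le (dissipative_t φ hφ), fun s hs => ?_⟩
  · refine ((hφ i).norm_le (measurable_window L) (abs_window_le L)).trans ?_
    rw [one_mul]
    exact Finset.single_le_sum (f := fun i => ‖c i t‖) (fun i _ => norm_nonneg _)
      (Finset.mem_univ i)
  · have Ioc_subset : Ioc s t ⊆ Ioo 0 T := fun r hr => ⟨hs.1.trans hr.1, hr.2.trans_lt ht.2⟩
    simp only [apply_eq]
    rw [intervalIntegral.integral_finsetSum fun i _ =>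
      (intervalIntegrable_iff_integrableOn_Ioc_of_le hs.2.le).2
        (IntegrableOn.mono_set ((h i).integrable_apply (φ i)) Ioc_subset),
      ← Finset.sum_sub_distrib]
    exact Finset.sum_le_sum fun i _ =>
      (h i).energy_sub_le hL hs.1 hs.2.le ht.2 (C_eq i) (hφ i)

theorem boundedAboveBy_of_dissipative (hU : IsOpen U) {L : ℝ} (hL : 0 ≤ L)
    (h : ∀ i, IsEvolution T (c i) (g i) (C i))
    (initial_le : ∀ i, ∀ᵐ x ∂volume.restrict U, C i 0 x ≤ L)
    (dissipative : ∀ᵐ t ∂timeMeasure T, ∀ φ : ι → H1 U,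
      (∀ i, H1.IsPrimitiveComp (window L) (c i t) (φ i)) → ∑ i, g i t (φ i) ≤ 0) (i : ι) :
    BoundedAboveBy T (c i) L := by
  filter_upwards [(h i).ae_eq, ae_restrict_mem measurableSet_Ioo] with t C_eq ht
  have energy_le := sum_energy_le_initial hU hL h dissipative (Ioo_subset_Icc_self ht)
  rw [Finset.sum_eq_zero (s := .univ) (f := fun i => energy L (C i 0)) fun i _ =>
    (energy_eq_zero_iff hL _).2 (initial_le i)] at energy_le
  have energy_nonneg : ∀ i ∈ Finset.univ, 0 ≤ energy L (C i t) := fun i _ =>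
    integral_nonneg fun x => rampEnergy_nonneg hL _
  rw [← C_eq]
  exact (energy_eq_zero_iff hL _).1 ((Finset.sum_eq_zero_iff_of_nonneg energy_nonneg).1
    (energy_le.antisymm (Finset.sum_nonneg energy_nonneg)) i (Finset.mem_univ i))

end Comparison

section DistributionalDerivative

theorem ae_eq_zero_of_integral_mul_apply_eq_zero {V X : Type*} [NormedAddCommGroup V]
    [NormedSpace ℝ V] [FiniteDimensional ℝ V] [MeasurableSpace V] [BorelSpace V]
    [NormedAddCommGroup X] [NormedSpace ℝ X] {μ : Measure V} {S : Set V}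
    [IsFiniteMeasure (μ.restrict S)] (hS : IsOpen S) {p : ℝ≥0∞} (hp : 1 ≤ p)
    {g : V → StrongDual ℝ X} (hg : MemLp g p (μ.restrict S))
    (h : ∀ η : V → ℝ, ContDiff ℝ ∞ η → HasCompactSupport η → tsupport η ⊆ S →
      ∀ x, ∫ t in S, η t * g t x ∂μ = 0) :
    ∀ᵐ t ∂μ.restrict S, g t = 0 := by
  rw [ae_restrict_iff' hS.measurableSet]
  refine hS.ae_eq_zero_of_integral_contDiff_smul_eq_zero
    (IntegrableOn.locallyIntegrableOn (hg.integrable hp))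
    fun η η_smooth η_compact η_supp => ?_
  rw [← setIntegral_eq_integral_of_forall_compl_eq_zero (s := S) fun t ht => by
    rw [image_eq_zero_of_notMem_tsupport fun h' => ht (η_supp h'), zero_smul]]
  obtain ⟨K, hK⟩ := η_smooth.continuous.bounded_above_of_compact_support η_compact
  have smul_integrable : Integrable (fun t => η t • g t) (μ.restrict S) :=
    (hg.integrable hp).bdd_smul K η_smooth.continuous.aestronglyMeasurable (Eventually.of_forall hK)
  ext x
  rw [ContinuousLinearMap.integral_apply smul_integrable]
  exact h η η_smooth η_compact η_supp x

variable {n : ℕ} {U : Set (E n)} {T : ℝ} {c c₁ c₂ : ℝ → H1 U}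
  {g g₁ g₂ : ℝ → StrongDual ℝ (H1 U)} {C C₁ C₂ : ℝ → L2 U}

theorem IsEvolution.integrable_inner (h : IsEvolution T c g C) (φ : H1 U) :
    Integrable (fun t => ⟪(c t).fn, φ.fn⟫) (timeMeasure T) := by
  have C_integrable : IntegrableOn (fun t => ⟪C t, φ.fn⟫) (Ioo 0 T) :=
    ((h.continuousOn.inner continuousOn_const).integrableOn_Icc).mono_set Ioo_subset_Icc_self
  refine Integrable.congr C_integrable ?_
  filter_upwards [h.ae_eq] with t C_eq
  rw [C_eq]

theorem integrable_mul_of_hasCompactSupport {η f : ℝ → ℝ} {μ : Measure ℝ} (hη : Continuous η)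
    (η_compact : HasCompactSupport η) (hf : Integrable f μ) :
    Integrable (fun t => η t * f t) μ := by
  obtain ⟨K, hK⟩ := hη.bounded_above_of_compact_support η_compact
  exact hf.bdd_mul hη.aestronglyMeasurable (Eventually.of_forall hK)

theorem IsEvolution.isWeakTimeDeriv_add (h₁ : IsEvolution T c₁ g₁ C₁)
    (h₂ : IsEvolution T c₂ g₂ C₂) :
    IsWeakTimeDeriv T (fun t => c₁ t + c₂ t) (fun t => g₁ t + g₂ t) := by
  intro φ η η_smooth η_compact η_supp
  have fn_integrable {c g C} (h : IsEvolution T c g C) :=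
    integrable_mul_of_hasCompactSupport (η_smooth.continuous_deriv (by simp)) η_compact.deriv
      (h.integrable_inner φ)
  have deriv_integrable {c g C} (h : IsEvolution T c g C) :=
    integrable_mul_of_hasCompactSupport η_smooth.continuous η_compact (h.integrable_apply φ)
  calc ∫ t, deriv η t * ⟪(c₁ t + c₂ t).fn, φ.fn⟫ ∂timeMeasure T
      = ∫ t, (deriv η t * ⟪(c₁ t).fn, φ.fn⟫ + deriv η t * ⟪(c₂ t).fn, φ.fn⟫) ∂timeMeasure T := by
        simp only [← mul_add, ← inner_add_left]
        rfl
    _ = -∫ t, (η t * g₁ t φ + η t * g₂ t φ) ∂timeMeasure T := by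
        rw [integral_add (fn_integrable h₁) (fn_integrable h₂),
          integral_add (deriv_integrable h₁) (deriv_integrable h₂), neg_add,
          h₁.weakDeriv φ η η_smooth η_compact η_supp, h₂.weakDeriv φ η η_smooth η_compact η_supp]
    _ = -∫ t, η t * (g₁ t + g₂ t) φ ∂timeMeasure T := by
        simp only [add_apply, mul_add]

theorem IsEvolution.add (h₁ : IsEvolution T c₁ g₁ C₁) (h₂ : IsEvolution T c₂ g₂ C₂) :
    IsEvolution T (fun t => c₁ t + c₂ t) (fun t => g₁ t + g₂ t) (fun t => C₁ t + C₂ t) where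
  mem := h₁.mem.add h₂.mem
  deriv_mem := memLp_dual_add h₁.deriv_mem h₂.deriv_mem
  weakDeriv := h₁.isWeakTimeDeriv_add h₂
  continuousOn := h₁.continuousOn.add h₂.continuousOn
  ae_eq := by
    filter_upwards [h₁.ae_eq, h₂.ae_eq] with t eq₁ eq₂
    rw [eq₁, eq₂]
    rfl

theorem IsEvolution.deriv_eq_zero_of_fn_eq (h : IsEvolution T c g C) {w : L2 U}
    (hw : ∀ᵐ t ∂timeMeasure T, (c t).fn = w) : ∀ᵐ t ∂timeMeasure T, g t = 0 := by
  have : IsFiniteMeasure (volume.restrict (Ioo 0 T)) := isFiniteMeasure_timeMeasure T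
  refine ae_eq_zero_of_integral_mul_apply_eq_zero (S := Ioo 0 T) isOpen_Ioo one_le_two h.deriv_mem
    fun η η_smooth η_compact η_supp φ => ?_
  have integral_deriv : ∫ t in Ioo 0 T, deriv η t = 0 := by
    rw [setIntegral_eq_integral_of_forall_compl_eq_zero fun t ht =>
      image_eq_zero_of_notMem_tsupport fun h' => ht (η_supp (tsupport_deriv_subset h'))]
    exact integral_eq_zero_of_hasDerivAt_of_integrable
      (fun t => (η_smooth.differentiable (by simp) t).hasDerivAt)
      ((η_smooth.continuous_deriv (by simp)).integrable_of_hasCompactSupport η_compact.deriv)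
      (η_smooth.continuous.integrable_of_hasCompactSupport η_compact)
  have weakDeriv := h.weakDeriv φ η η_smooth η_compact η_supp
  rw [integral_congr_ae (g := fun t => deriv η t * ⟪w, φ.fn⟫) (hw.mono fun t ht => by rw [ht]),
    integral_mul_const, timeMeasure, integral_deriv, zero_mul] at weakDeriv
  exact neg_eq_zero.1 weakDeriv.symm

theorem IsEvolution.eq_of_fn_eq (h : IsEvolution T c g C) {w : L2 U}
    (hw : ∀ᵐ t ∂timeMeasure T, (c t).fn = w) {t : ℝ} (hT : 0 < T) (ht : t ∈ Icc 0 T) :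
    C t = w := by
  have C_ae_eq : C =ᵐ[volume.restrict (Icc 0 T)] fun _ => w := by
    rw [← Measure.restrict_congr_set Ioo_ae_eq_Icc]
    filter_upwards [hw, h.ae_eq] with s fn_eq C_eq
    rw [C_eq, fn_eq]
  exact Measure.eqOn_Icc_of_ae_eq volume hT.ne C_ae_eq h.continuousOn continuousOn_const ht

end DistributionalDerivative

section VolumeAdditivity

variable {n : ℕ} {U : Set (E n)} {T : ℝ} {c₁ c₂ : ℝ → H1 U}
  {g₁ g₂ : ℝ → StrongDual ℝ (H1 U)} {C₁ C₂ : ℝ → L2 U}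
  [IsFiniteMeasure ((volume : Measure (E n)).restrict U)]

theorem H1.grad_eq_zero_of_fn_eq_const (hU : IsOpen U) {u : H1 U} {a : ℝ}
    (h : ∀ᵐ x ∂volume.restrict U, u.fn x = a) :
    ∀ᵐ x ∂volume.restrict U, u.grad x = 0 := by
  have grad_integrable : IntegrableOn u.grad U := (Lp.memLp u.grad).integrable one_le_two
  have gradient_const : gradient (fun _ : E n => a) = 0 := by
    funext x
    simp only [gradient, fderiv_fun_const, Pi.zero_apply, map_zero]
  rw [ae_restrict_iff' hU.measurableSet]
  refine hU.ae_eq_zero_of_integral_contDiff_smul_eq_zero grad_integrable.locallyIntegrableOn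
    fun φ φ_smooth φ_compact φ_supp => ?_
  have test : IsTestFunction U φ := ⟨φ_smooth, φ_compact, φ_supp⟩
  rw [← setIntegral_eq_integral_of_forall_compl_eq_zero (s := U) fun x hx => by
    rw [image_eq_zero_of_notMem_tsupport fun h' => hx (φ_supp h'), zero_smul]]
  have const_weak := isWeakGradient_gradient (U := U) (contDiff_const (c := a)) φ test
  rw [gradient_const, integral_congr_ae (g := fun x => u.fn x • gradient φ x)
    (h.mono fun x hx => by simp only [hx]), u.isWeakGradient φ test, neg_inj] at const_weak
  rw [const_weak]
  simp only [Pi.zero_apply, smul_zero, integral_zero]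

theorem H1.fn_add_eq_const {u w : H1 U}
    {a : ℝ} (h : ∀ᵐ x ∂volume.restrict U, u.fn x + w.fn x = a) :
    (u + w).fn = Lp.const 2 (volume.restrict U) a := by
  refine Lp.ext ?_
  filter_upwards [h, Lp.coeFn_add u.fn w.fn, Lp.coeFn_const 2 (volume.restrict U) a]
    with x hx add_eq const_eq
  rw [const_eq, Function.const_apply, ← hx]
  exact add_eq

theorem H1.grad_add_eq_zero (hU : IsOpen U) {u w : H1 U} {a : ℝ}
    (h : ∀ᵐ x ∂volume.restrict U, u.fn x + w.fn x = a) :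
    ∀ᵐ x ∂volume.restrict U, u.grad x + w.grad x = 0 := by
  have fn_eq : ∀ᵐ x ∂volume.restrict U, (u + w).fn x = a := by
    rw [fn_add_eq_const h]
    exact Lp.coeFn_const 2 (volume.restrict U) a
  filter_upwards [grad_eq_zero_of_fn_eq_const hU fn_eq, Lp.coeFn_add u.grad w.grad]
    with x grad_eq add_eq
  exact add_eq.symm.trans grad_eq

theorem VolumeAdditivity.deriv_add_eq_zero
    (h : VolumeAdditivity T c₁ c₂) (h₁ : IsEvolution T c₁ g₁ C₁) (h₂ : IsEvolution T c₂ g₂ C₂) :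
    ∀ᵐ t ∂timeMeasure T, g₁ t + g₂ t = 0 :=
  (h₁.add h₂).deriv_eq_zero_of_fn_eq (h.mono fun _ ht => H1.fn_add_eq_const ht)

theorem VolumeAdditivity.initial_add_eq_one (h : VolumeAdditivity T c₁ c₂)
    (h₁ : IsEvolution T c₁ g₁ C₁) (h₂ : IsEvolution T c₂ g₂ C₂) (hT : 0 < T) :
    ∀ᵐ x ∂volume.restrict U, C₁ 0 x + C₂ 0 x = 1 := by
  have total_eq : C₁ 0 + C₂ 0 = Lp.const 2 (volume.restrict U) 1 :=
    (h₁.add h₂).eq_of_fn_eq (h.mono fun _ ht => H1.fn_add_eq_const ht) hT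
      (left_mem_Icc.2 hT.le)
  filter_upwards [Lp.coeFn_add (C₁ 0) (C₂ 0), Lp.coeFn_const 2 (volume.restrict U) (1 : ℝ)]
    with x add_eq const_eq
  rw [← Pi.add_apply, ← add_eq, total_eq, const_eq, Function.const_apply]

end VolumeAdditivity

section Dissipation

variable {n : ℕ} {U : Set (E n)} {L z ε γ : ℝ}

/-- The field `v` is divergence free in `U` with vanishing normal component on `∂U`; the boundary
condition is encoded in the test functions, which need not vanish on `∂U`. -/
def IsSolenoidal (v : H1Vec U) : Prop :=
  ∀ χ : H1 U, ∫ x in U, ⟪v.fn x, χ.grad x⟫ = 0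

/-- The Nernst–Planck equation at a fixed time for a species `c` of charge `z`, with `r` in the
role of `∂ₜc` and `c'` the species of opposite charge. The reaction term is written as `-(c - c')`,
which has the same form for both species. -/
structure SolvesTransport (z ε γ : ℝ) (v : H1Vec U) (Φ c c' : H1 U) (r : H1 U → ℝ) : Prop where
  flux_integrable : ∀ φ, Integrable (fluxTerm z ε γ v Φ c φ) (volume.restrict U)
  apply_add : ∀ φ, r φ + ∫ x in U, fluxTerm z ε γ v Φ c φ x =
    -∫ x in U, (c.fn x - c'.fn x) * φ.fn x

theorem window_of_mem {s : ℝ} (hs : s ∈ Ioc L (L + 1)) : window L s = 1 :=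
  indicator_of_mem hs 1

theorem window_of_notMem {s : ℝ} (hs : s ∉ Ioc L (L + 1)) : window L s = 0 :=
  indicator_of_notMem hs 1

theorem abs_mul_window_le {f : ℝ → ℝ} {B : ℝ} (hB : ∀ s ∈ Ioc L (L + 1), |f s| ≤ B) (s : ℝ) :
    |f s * window L s| ≤ B := by
  by_cases hs : s ∈ Ioc L (L + 1)
  · rw [window_of_mem hs, mul_one]
    exact hB s hs
  · rw [window_of_notMem hs, mul_zero, abs_zero]
    exact (abs_nonneg _).trans (hB (L + 1) (right_mem_Ioc.2 (lt_add_one L)))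

theorem H1.exists_isPrimitiveComp_mul_window
    [IsFiniteMeasure ((volume : Measure (E n)).restrict U)] (hU : IsOpen U) {f : ℝ → ℝ} {B : ℝ}
    (hf : Measurable f) (hB : ∀ s ∈ Ioc L (L + 1), |f s| ≤ B) (u : H1 U) :
    ∃ θ, IsPrimitiveComp (fun s => f s * window L s) u θ := by
  have f_integrable : IntegrableOn f (Ioc L (L + 1)) :=
    Measure.integrableOn_of_bounded measure_Ioc_lt_top.ne hf.aestronglyMeasurable
      ((ae_restrict_mem measurableSet_Ioc).mono hB)
  have product_eq : ∀ s, (Ioc L (L + 1)).indicator f s = f s * window L s := fun s => by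
    simp only [window, ← indicator_mul_right, Pi.one_apply, mul_one]
  refine u.exists_isPrimitiveComp (hf.mul (measurable_window L)) (abs_mul_window_le hB) hU
    (isFiniteMeasure_restrict.1 inferInstance) ?_
  exact (f_integrable.integrable_indicator measurableSet_Ioc).congr
    (Eventually.of_forall product_eq)

theorem H1.exists_isPrimitiveComp_moment
    [IsFiniteMeasure ((volume : Measure (E n)).restrict U)] (hU : IsOpen U) (hL : 0 ≤ L)
    (u : H1 U) : ∃ χ, IsPrimitiveComp (fun s => s * window L s) u χ :=
  exists_isPrimitiveComp_mul_window (B := L + 1) hU measurable_id (fun s hs => by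
    rw [id, abs_of_pos (hL.trans_lt hs.1)]
    exact hs.2) u

theorem max_mul_window (hL : 0 ≤ L) (s : ℝ) : max 0 s * window L s = s * window L s := by
  by_cases hs : s ∈ Ioc L (L + 1)
  · rw [max_eq_right (hL.trans hs.1.le)]
  · rw [window_of_notMem hs, mul_zero, mul_zero]

/-- The diffusive flux dissipates the truncation `φ`; the convective flux does not contribute,
because `c ∇φ` is the gradient of the moment `χ`. -/
theorem SolvesTransport.apply_le {v : H1Vec U} {Φ c c' φ χ : H1 U} {r : H1 U → ℝ}
    (h : SolvesTransport z ε γ v Φ c c' r) (hv : IsSolenoidal v) (hL : 0 ≤ L)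
    (hφ : H1.IsPrimitiveComp (window L) c φ)
    (hχ : H1.IsPrimitiveComp (fun s => s * window L s) c χ) :
    r φ ≤ -(∫ x in U, (c.fn x - c'.fn x) * φ.fn x) -
      z * ε ^ γ * ∫ x in U, ⟪Φ.grad x, χ.grad x⟫ := by
  have diffusion_nonneg : 0 ≤ ∫ x in U, ⟪c.grad x, φ.grad x⟫ := by
    refine integral_nonneg_of_ae ?_
    filter_upwards [hφ.grad_eq] with x grad_eq
    rw [grad_eq, real_inner_smul_right]
    exact mul_nonneg (window_nonneg _ _) real_inner_self_nonneg
  have diffusion_integrable : Integrable (fun x => ⟪c.grad x, φ.grad x⟫) (volume.restrict U) :=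
    L2.integrable_inner _ _
  have drift_integrable : Integrable (fun x => z * ε ^ γ * ⟪Φ.grad x, χ.grad x⟫)
      (volume.restrict U) := (L2.integrable_inner _ _).const_mul _
  have total_integrable : Integrable (fun x =>
      ⟪c.grad x, φ.grad x⟫ + z * ε ^ γ * ⟪Φ.grad x, χ.grad x⟫) (volume.restrict U) :=
    diffusion_integrable.add drift_integrable
  have convection : ∫ x in U, (⟪c.grad x, φ.grad x⟫ + z * ε ^ γ * ⟪Φ.grad x, χ.grad x⟫ -
      fluxTerm z ε γ v Φ c φ x) = ∫ x in U, ⟪v.fn x, χ.grad x⟫ := by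
    refine integral_congr_ae ?_
    filter_upwards [hφ.grad_eq, hχ.grad_eq] with x φ_eq χ_eq
    simp only [fluxTerm, φ_eq, χ_eq, real_inner_smul_right, inner_add_left, inner_neg_left,
      real_inner_smul_left]
    linear_combination -(z * ε ^ γ * ⟪Φ.grad x, c.grad x⟫) * max_mul_window hL (c.fn x)
  rw [hv, integral_sub total_integrable (h.flux_integrable φ),
    integral_add diffusion_integrable drift_integrable, integral_const_mul] at convection
  linarith [h.apply_add φ]

end Dissipation

section Neumann

variable {n : ℕ} {U : Set (E n)} {L z ε γ : ℝ}

theorem monotone_primitive {f : ℝ → ℝ} {B : ℝ} (hf : Measurable f) (hB : ∀ s, |f s| ≤ B)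
    (f_nonneg : ∀ s, 0 ≤ f s) : Monotone (primitive f) := fun a b hab => by
  rw [← sub_nonneg, primitive_sub hf hB]
  exact intervalIntegral.integral_nonneg hab fun s _ => f_nonneg s

theorem H1.IsPrimitiveComp.integral_sub_mul_le {f : ℝ → ℝ} (hf : Monotone (primitive f))
    {u w a b : H1 U} (ha : IsPrimitiveComp f u a) (hb : IsPrimitiveComp f w b) :
    ∫ x in U, (u.fn x - w.fn x) * b.fn x ≤ ∫ x in U, (u.fn x - w.fn x) * a.fn x := by
  have product_integrable : ∀ y : H1 U,
      Integrable (fun x => (u.fn x - w.fn x) * y.fn x) (volume.restrict U) := fun y =>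
    ((Lp.memLp u.fn).sub (Lp.memLp w.fn)).integrable_mul (Lp.memLp y.fn)
  refine integral_mono_ae (product_integrable b) (product_integrable a) ?_
  filter_upwards [ha.fn_eq, hb.fn_eq] with x a_eq b_eq
  have := monovary_iff_forall_mul_nonneg.1 (hf.monovary monotone_id) (w.fn x) (u.fn x)
  rw [id, id] at this
  rw [a_eq, b_eq]
  linarith

/-- The Poisson equation turns the total drift into the integral of the charge `c - c'` against
the difference of the moments, which has the sign of the charge. -/
theorem neumann_dissipative [IsFiniteMeasure ((volume : Measure (E n)).restrict U)]
    (hU : IsOpen U) (hL : 0 ≤ L) (hε : 0 ≤ ε) (hz : 0 ≤ z) {v : H1Vec U} {Φ c c' φ φ' : H1 U}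
    {r r' : H1 U → ℝ} (h : SolvesTransport z ε γ v Φ c c' r)
    (h' : SolvesTransport (-z) ε γ v Φ c' c r') (hv : IsSolenoidal v) {κ : ℝ} (hκ : 0 < κ)
    (poisson : ∀ χ : H1 U, κ * ∫ x in U, ⟪Φ.grad x, χ.grad x⟫ =
      ∫ x in U, (c.fn x - c'.fn x) * χ.fn x)
    (hφ : H1.IsPrimitiveComp (window L) c φ) (hφ' : H1.IsPrimitiveComp (window L) c' φ') :
    r φ + r' φ' ≤ 0 := by
  obtain ⟨χ, hχ⟩ := H1.exists_isPrimitiveComp_moment hU hL c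
  obtain ⟨χ', hχ'⟩ := H1.exists_isPrimitiveComp_moment hU hL c'
  have ramp_monotone : Monotone (primitive (window L)) :=
    monotone_primitive (measurable_window L) (abs_window_le L) (window_nonneg L)
  have moment_monotone : Monotone (primitive fun s => s * window L s) := by
    refine monotone_primitive (measurable_id.mul (measurable_window L))
      (abs_mul_window_le (B := L + 1) fun s hs => ?_) fun s => ?_
    · rw [abs_of_pos (hL.trans_lt hs.1)]
      exact hs.2
    · rw [← max_mul_window hL]
      exact mul_nonneg (le_max_left _ _) (window_nonneg L s)
  have drift_le : ∫ x in U, ⟪Φ.grad x, χ'.grad x⟫ ≤ ∫ x in U, ⟪Φ.grad x, χ.grad x⟫ := by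
    rw [← mul_le_mul_iff_right₀ hκ, poisson, poisson]
    exact hχ.integral_sub_mul_le moment_monotone hχ'
  have reaction_eq : ∫ x in U, (c'.fn x - c.fn x) * φ'.fn x =
      -∫ x in U, (c.fn x - c'.fn x) * φ'.fn x := by
    simp only [← integral_neg, ← neg_mul, neg_sub]
  have reaction_le := hφ.integral_sub_mul_le ramp_monotone hφ'
  have drift_mul_le := mul_le_mul_of_nonneg_left drift_le (mul_nonneg hz (ε.rpow_nonneg hε γ))
  linarith [h.apply_le hv hL hφ hχ, h'.apply_le hv hL hφ' hχ']

end Neumann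

section AdditiveDissipation

variable {n : ℕ} {U : Set (E n)} {L z ε γ : ℝ}

/-- The difference of the mobilities of `c` and `1 - c`: it carries the drift of the total
concentration under volume additivity. -/
def netMobility (s : ℝ) : ℝ := max 0 s - max 0 (1 - s)

theorem monotone_netMobility : Monotone netMobility := fun a b h => by
  unfold netMobility
  gcongr

theorem netMobility_pos {s : ℝ} (hs : 1 / 2 < s) : 0 < netMobility s :=
  sub_pos.2 (max_lt (lt_max_of_lt_right (by linarith)) (lt_max_of_lt_right (by linarith)))

theorem H1.exists_isPrimitiveComp_div_netMobility
    [IsFiniteMeasure ((volume : Measure (E n)).restrict U)] (hU : IsOpen U) (hL : 1 / 2 < L)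
    (u : H1 U) : ∃ θ, IsPrimitiveComp (fun s => s / netMobility s * window L s) u θ := by
  refine exists_isPrimitiveComp_mul_window (f := fun s => s / netMobility s)
    (B := (L + 1) / netMobility L) hU
    (measurable_id.div monotone_netMobility.measurable) (fun s hs => ?_) u
  rw [abs_of_pos (div_pos (by linarith [hs.1]) (netMobility_pos (hL.trans hs.1)))]
  exact div_le_div₀ (by linarith) hs.2 (netMobility_pos hL) (monotone_netMobility hs.1.le)

theorem netMobility_mul_div_mul_window (hL : 1 / 2 < L) (s : ℝ) :
    netMobility s * (s / netMobility s * window L s) = s * window L s := by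
  by_cases hs : s ∈ Ioc L (L + 1)
  · rw [← mul_assoc, mul_div_cancel₀ _ (netMobility_pos (hL.trans hs.1)).ne']
  · simp only [window_of_notMem hs, mul_zero]

theorem fluxTerm_add_fluxTerm {v : H1Vec U} {Φ c c' φ : H1 U} {x : E n}
    (fn_add : c.fn x + c'.fn x = 1) (grad_add : c.grad x + c'.grad x = 0) :
    fluxTerm z ε γ v Φ c φ x + fluxTerm (-z) ε γ v Φ c' φ x =
      z * ε ^ γ * (netMobility (c.fn x) * ⟪Φ.grad x, φ.grad x⟫) - ⟪v.fn x, φ.grad x⟫ := by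
  rw [← eq_neg_iff_add_eq_zero] at grad_add
  simp only [fluxTerm, netMobility, grad_add, ← fn_add, add_sub_cancel_left, inner_add_left,
    inner_neg_left, real_inner_smul_left]
  linear_combination -⟪v.fn x, φ.grad x⟫ * fn_add

/-- The drifts of both species against a function of `c` cancel; dividing the test function by
the net mobility isolates the drift of `c` alone. -/
theorem SolvesTransport.drift_eq_zero [IsFiniteMeasure ((volume : Measure (E n)).restrict U)]
    {v : H1Vec U} {Φ c c' χ : H1 U} {r r' : H1 U → ℝ} (h : SolvesTransport z ε γ v Φ c c' r)
    (h' : SolvesTransport (-z) ε γ v Φ c' c r') (hU : IsOpen U) (hv : IsSolenoidal v)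
    (hL : 1 / 2 < L) (additive : ∀ᵐ x ∂volume.restrict U, c.fn x + c'.fn x = 1)
    (r_add : ∀ φ, r φ + r' φ = 0)
    (hχ : H1.IsPrimitiveComp (fun s => s * window L s) c χ) :
    z * ε ^ γ * ∫ x in U, ⟪Φ.grad x, χ.grad x⟫ = 0 := by
  obtain ⟨θ, hθ⟩ := c.exists_isPrimitiveComp_div_netMobility hU hL
  have flux_add : (∫ x in U, fluxTerm z ε γ v Φ c θ x) +
      ∫ x in U, fluxTerm (-z) ε γ v Φ c' θ x = 0 := by
    have reaction_eq : ∫ x in U, (c'.fn x - c.fn x) * θ.fn x =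
        -∫ x in U, (c.fn x - c'.fn x) * θ.fn x := by
      simp only [← integral_neg, ← neg_mul, neg_sub]
    linarith [h.apply_add θ, h'.apply_add θ, r_add θ]
  have drift_integrable : Integrable (fun x => z * ε ^ γ * ⟪Φ.grad x, χ.grad x⟫)
      (volume.restrict U) := (L2.integrable_inner _ _).const_mul _
  have flux_integrable : Integrable (fun x =>
      fluxTerm z ε γ v Φ c θ x + fluxTerm (-z) ε γ v Φ c' θ x) (volume.restrict U) :=
    (h.flux_integrable θ).add (h'.flux_integrable θ)
  have convection : ∫ x in U, (z * ε ^ γ * ⟪Φ.grad x, χ.grad x⟫ -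
      (fluxTerm z ε γ v Φ c θ x + fluxTerm (-z) ε γ v Φ c' θ x)) =
      ∫ x in U, ⟪v.fn x, θ.grad x⟫ := by
    refine integral_congr_ae ?_
    filter_upwards [hθ.grad_eq, hχ.grad_eq, additive, H1.grad_add_eq_zero hU additive]
      with x θ_eq χ_eq fn_add grad_add
    have mobility := netMobility_mul_div_mul_window hL (c.fn x)
    rw [fluxTerm_add_fluxTerm fn_add grad_add]
    simp only [θ_eq, χ_eq, real_inner_smul_right]
    linear_combination -(z * ε ^ γ * ⟪Φ.grad x, c.grad x⟫) * mobility
  rw [hv, integral_sub drift_integrable flux_integrable,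
    integral_add (h.flux_integrable θ) (h'.flux_integrable θ), flux_add, sub_zero,
    integral_const_mul] at convection
  exact convection

theorem SolvesTransport.apply_nonpos_of_add_eq_one
    [IsFiniteMeasure ((volume : Measure (E n)).restrict U)] {v : H1Vec U} {Φ c c' φ : H1 U}
    {r r' : H1 U → ℝ} (h : SolvesTransport z ε γ v Φ c c' r)
    (h' : SolvesTransport (-z) ε γ v Φ c' c r') (hU : IsOpen U) (hv : IsSolenoidal v)
    (hL : 1 / 2 < L) (additive : ∀ᵐ x ∂volume.restrict U, c.fn x + c'.fn x = 1)
    (r_add : ∀ φ, r φ + r' φ = 0) (hφ : H1.IsPrimitiveComp (window L) c φ) : r φ ≤ 0 := by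
  have L_nonneg : 0 ≤ L := by linarith
  obtain ⟨χ, hχ⟩ := c.exists_isPrimitiveComp_moment hU L_nonneg
  have reaction_nonneg : 0 ≤ ∫ x in U, (c.fn x - c'.fn x) * φ.fn x := by
    refine integral_nonneg_of_ae ?_
    filter_upwards [hφ.fn_eq, additive] with x φ_eq fn_add
    rw [φ_eq, primitive_window L_nonneg]
    rcases le_total (c.fn x) L with hc | hc
    · rw [ramp_of_le hc, mul_zero, Pi.zero_apply]
    · exact mul_nonneg (by linarith) (ramp_nonneg L _)
  linarith [h.apply_le hv L_nonneg hφ hχ, h.drift_eq_zero h' hU hv hL additive r_add hχ]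

end AdditiveDissipation

section Bounds

variable {n : ℕ} {U Γ ΓD : Set (E n)} {z ε α β γ σ ΦD T L M : ℝ} {c₀p c₀m c₀ : E n → ℝ}
  {v : ℝ → H1Vec U} {p : ℝ → L2 U} {Φ cp cm c c' : ℝ → H1 U}

theorem SolvesNernstPlanck.exists_isEvolution (h : SolvesNernstPlanck U z ε γ T c₀ v Φ cp cm c)
    (charge_eq : ∀ t x, z * ((cp t).fn x - (cm t).fn x) = (c t).fn x - (c' t).fn x) :
    ∃ g C, IsEvolution T c g C ∧ (∀ᵐ x ∂volume.restrict U, C 0 x = c₀ x) ∧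
      ∀ᵐ t ∂timeMeasure T, SolvesTransport z ε γ (v t) (Φ t) (c t) (c' t) (g t) := by
  obtain ⟨g, g_memLp, weakDeriv, equation⟩ := h.equation
  obtain ⟨C, C_continuous, C_eq, initial⟩ := h.initial
  refine ⟨g, C, ⟨h.mem_L2_H1, g_memLp, weakDeriv, C_continuous, C_eq⟩, initial, ?_⟩
  filter_upwards [equation] with t equation_t
  refine ⟨fun φ => (equation_t φ).1, fun φ => (equation_t φ).2.trans ?_⟩
  simp only [charge_eq, neg_mul, integral_neg]

theorem SolvesNernstPlanck.exists_isEvolution_pos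
    (h : SolvesNernstPlanck U 1 ε γ T c₀ v Φ cp cm cp) :
    ∃ g C, IsEvolution T cp g C ∧ (∀ᵐ x ∂volume.restrict U, C 0 x = c₀ x) ∧
      ∀ᵐ t ∂timeMeasure T, SolvesTransport 1 ε γ (v t) (Φ t) (cp t) (cm t) (g t) :=
  h.exists_isEvolution fun _ _ => one_mul _

theorem SolvesNernstPlanck.exists_isEvolution_neg
    (h : SolvesNernstPlanck U (-1) ε γ T c₀ v Φ cp cm cm) :
    ∃ g C, IsEvolution T cm g C ∧ (∀ᵐ x ∂volume.restrict U, C 0 x = c₀ x) ∧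
      ∀ᵐ t ∂timeMeasure T, SolvesTransport (-1) ε γ (v t) (Φ t) (cm t) (cp t) (g t) :=
  h.exists_isEvolution fun _ _ => by ring

theorem BoundedAboveBy.of_forall_gt (h : ∀ L, M < L → BoundedAboveBy T c L) :
    BoundedAboveBy T c M := by
  obtain ⟨L, -, L_gt, L_tendsto⟩ := exists_seq_strictAnti_tendsto M
  filter_upwards [ae_all_iff.2 fun k => h (L k) (L_gt k)] with t ht
  filter_upwards [ae_all_iff.2 ht] with x hx
  exact ge_of_tendsto' L_tendsto hx

theorem VolumeAdditivity.symm (h : VolumeAdditivity T c c') : VolumeAdditivity T c' c :=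
  h.mono fun _ ht => ht.mono fun _ hx => by rwa [add_comm]

variable [IsFiniteMeasure ((volume : Measure (E n)).restrict U)]

theorem VolumeAdditivity.boundedAboveBy {g g' : ℝ → StrongDual ℝ (H1 U)} {C C' : ℝ → L2 U}
    (additive : VolumeAdditivity T c c') (hU : IsOpen U) (hM : 1 / 2 ≤ M)
    (evolution : IsEvolution T c g C) (evolution' : IsEvolution T c' g' C')
    (transport : ∀ᵐ t ∂timeMeasure T, SolvesTransport z ε γ (v t) (Φ t) (c t) (c' t) (g t))
    (transport' : ∀ᵐ t ∂timeMeasure T,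
      SolvesTransport (-z) ε γ (v t) (Φ t) (c' t) (c t) (g' t))
    (solenoidal : ∀ᵐ t ∂timeMeasure T, IsSolenoidal (v t))
    (initial_le : ∀ᵐ x ∂volume.restrict U, C 0 x ≤ M) : BoundedAboveBy T c M := by
  refine .of_forall_gt fun L hL => ?_
  refine boundedAboveBy_of_dissipative (ι := Unit) hU (by linarith) (fun _ => evolution)
    (fun _ => initial_le.mono fun _ hx => hx.trans hL.le) ?_ ()
  filter_upwards [transport, transport', solenoidal, additive,
    additive.deriv_add_eq_zero evolution evolution'] with t ht ht' hv fn_add deriv_add φ hφ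
  rw [Fintype.sum_unique]
  refine ht.apply_nonpos_of_add_eq_one ht' hU hv (hM.trans_lt hL) fn_add (fun φ => ?_) (hφ ())
  rw [← add_apply, deriv_add, zero_apply]

theorem IsWeakSolution.boundedAboveBy_of_volumeAdditivity (hU : IsOpen U)
    (h : IsWeakSolution U Γ ΓD ε α β γ σ ΦD T c₀p c₀m v p Φ cp cm)
    (additive : VolumeAdditivity T cp cm) (hM : 1 / 2 ≤ M)
    (hc₀p : ∀ᵐ x ∂volume.restrict U, c₀p x ≤ M) (hc₀m : ∀ᵐ x ∂volume.restrict U, c₀m x ≤ M) :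
    BoundedAboveBy T cp M ∧ BoundedAboveBy T cm M := by
  obtain ⟨gp, Cp, evolution_p, initial_p, transport_p⟩ :=
    h.nernst_planck_pos.exists_isEvolution_pos
  obtain ⟨gm, Cm, evolution_m, initial_m, transport_m⟩ :=
    h.nernst_planck_neg.exists_isEvolution_neg
  constructor
  · refine additive.boundedAboveBy hU hM evolution_p evolution_m transport_p transport_m
      h.stokes.incompressible ?_
    filter_upwards [initial_p, hc₀p] with x hx c₀_le using hx.trans_le c₀_le
  · refine additive.symm.boundedAboveBy hU hM evolution_m evolution_p transport_m
      (by rwa [neg_neg]) h.stokes.incompressible ?_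
    filter_upwards [initial_m, hc₀m] with x hx c₀_le using hx.trans_le c₀_le

theorem IsWeakSolution.initial_add_eq_one (hT : 0 < T)
    (h : IsWeakSolution U Γ ΓD ε α β γ σ ΦD T c₀p c₀m v p Φ cp cm)
    (additive : VolumeAdditivity T cp cm) : ∀ᵐ x ∂volume.restrict U, c₀p x + c₀m x = 1 := by
  obtain ⟨gp, Cp, evolution_p, initial_p, -⟩ := h.nernst_planck_pos.exists_isEvolution_pos
  obtain ⟨gm, Cm, evolution_m, initial_m, -⟩ := h.nernst_planck_neg.exists_isEvolution_neg
  filter_upwards [initial_p, initial_m,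
    additive.initial_add_eq_one evolution_p evolution_m hT] with x hp hm hx
  rwa [← hp, ← hm]

theorem IsWeakSolution.boundedAboveBy_of_neumann (hU : IsOpen U) (hε : 0 < ε)
    (h : IsWeakSolution U Γ ∅ ε α β γ 0 ΦD T c₀p c₀m v p Φ cp cm) (hM : 0 ≤ M)
    (hc₀p : ∀ᵐ x ∂volume.restrict U, c₀p x ≤ M) (hc₀m : ∀ᵐ x ∂volume.restrict U, c₀m x ≤ M) :
    BoundedAboveBy T cp M ∧ BoundedAboveBy T cm M := by
  obtain ⟨gp, Cp, evolution_p, initial_p, transport_p⟩ :=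
    h.nernst_planck_pos.exists_isEvolution_pos
  obtain ⟨gm, Cm, evolution_m, initial_m, transport_m⟩ :=
    h.nernst_planck_neg.exists_isEvolution_neg
  have evolution : ∀ i : Fin 2, IsEvolution T (![cp, cm] i) (![gp, gm] i) (![Cp, Cm] i) :=
    Fin.forall_fin_two.2 ⟨evolution_p, evolution_m⟩
  have initial_le : ∀ i : Fin 2, ∀ᵐ x ∂volume.restrict U, ![Cp, Cm] i 0 x ≤ M := by
    refine Fin.forall_fin_two.2 ⟨?_, ?_⟩
    · filter_upwards [initial_p, hc₀p] with x hx c₀_le using hx.trans_le c₀_le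
    · filter_upwards [initial_m, hc₀m] with x hx c₀_le using hx.trans_le c₀_le
  refine Fin.forall_fin_two.1 (boundedAboveBy_of_dissipative hU hM evolution initial_le ?_)
  filter_upwards [transport_p, transport_m, h.stokes.incompressible, h.poisson.equation]
    with t ht ht' hv poisson φ hφ
  rw [Fin.sum_univ_two]
  refine neumann_dissipative hU hM hε.le zero_le_one ht ht' hv (Real.rpow_pos_of_pos hε α)
    (fun χ => ?_) (hφ 0) (hφ 1)
  simpa [integral_const_mul] using poisson χ (by simp)

end Bounds

end SNPP

end

open SNPP in
theorem mainTheorem12_general {n : ℕ} {U Γ ΓD : Set (E n)} (hU : IsOpen U)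
    (hU_finite : volume U ≠ ⊤) {ε α β γ σ ΦD T Λ : ℝ} (hε : 0 < ε) (hT : 0 < T)
    {c₀p c₀m : E n → ℝ} (hc₀p : ∀ᵐ x ∂volume.restrict U, c₀p x ∈ Icc 0 Λ)
    (hc₀m : ∀ᵐ x ∂volume.restrict U, c₀m x ∈ Icc 0 Λ) {v : ℝ → H1Vec U} {p : ℝ → L2 U}
    {Φ cp cm : ℝ → H1 U} (h : IsWeakSolution U Γ ΓD ε α β γ σ ΦD T c₀p c₀m v p Φ cp cm) :
    (VolumeAdditivity T cp cm →
      (BoundedAboveBy T cp Λ ∧ BoundedAboveBy T cm Λ) ∧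
      (BoundedAboveBy T cp 1 ∧ BoundedAboveBy T cm 1)) ∧
    (ΓD = ∅ → σ = 0 → BoundedAboveBy T cp Λ ∧ BoundedAboveBy T cm Λ) := by
  have : IsFiniteMeasure (volume.restrict U) := isFiniteMeasure_restrict.2 hU_finite
  rcases (ae (volume.restrict U)).eq_or_neBot with ae_bot | _
  · simp [BoundedAboveBy, ae_bot]
  refine ⟨fun additive => ?_, ?_⟩
  · have initial_add := h.initial_add_eq_one hT additive
    have half_le : 1 / 2 ≤ Λ := by
      obtain ⟨x, hp, hm, hx⟩ := (hc₀p.and (hc₀m.and initial_add)).exists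
      linarith [hp.2, hm.2]
    refine ⟨h.boundedAboveBy_of_volumeAdditivity hU additive half_le (hc₀p.mono fun _ hx => hx.2)
      (hc₀m.mono fun _ hx => hx.2),
      h.boundedAboveBy_of_volumeAdditivity hU additive one_half_lt_one.le ?_ ?_⟩
    · filter_upwards [hc₀m, initial_add] with x hm hx using by linarith [hm.1]
    · filter_upwards [hc₀p, initial_add] with x hp hx using by linarith [hp.1]
  · rintro rfl rfl
    obtain ⟨x, hx⟩ := hc₀p.exists
    exact h.boundedAboveBy_of_neumann hU hε (hx.1.trans hx.2) (hc₀p.mono fun _ hx => hx.2)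
      (hc₀m.mono fun _ hx => hx.2)

theorem mainTheorem12 {n : ℕ} (hn1 : 1 ≤ n) (hn3 : n ≤ 3)
    (Ω Yl Ys : Set (SNPP.E n)) (hΩ : IsOpen Ω) (hΩb : Bornology.IsBounded Ω)
    (hΩc : IsConnected Ω) (hY : SNPP.IsCellDecomposition Yl Ys)
    (α β γ σ ΦD T Λ : ℝ) (hT : 0 < T)
    (c₀p c₀m : SNPP.E n → ℝ)
    (hc₀p_meas : AEStronglyMeasurable c₀p (volume.restrict Ω))
    (hc₀m_meas : AEStronglyMeasurable c₀m (volume.restrict Ω))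
    (hc₀p : ∀ x ∈ Ω, 0 ≤ c₀p x ∧ c₀p x ≤ Λ)
    (hc₀m : ∀ x ∈ Ω, 0 ≤ c₀m x ∧ c₀m x ≤ Λ) :
    ∀ ε : ℝ, 0 < ε → ε < 1 → SNPP.IsCoveredByCells Ω ε →
      IsConnected (SNPP.poreSpace Ω Yl ε) →
      SNPP.HasLipschitzBoundary (SNPP.poreSpace Ω Yl ε) →
      ∀ ΓD : Set (SNPP.E n), MeasurableSet ΓD → ΓD ⊆ SNPP.innerBoundary Ω Yl Ys ε →
      ∀ (v : ℝ → SNPP.H1Vec (SNPP.poreSpace Ω Yl ε)) (p : ℝ → SNPP.L2 (SNPP.poreSpace Ω Yl ε))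
        (Φ cp cm : ℝ → SNPP.H1 (SNPP.poreSpace Ω Yl ε)),
      SNPP.IsWeakSolution (SNPP.poreSpace Ω Yl ε) (SNPP.innerBoundary Ω Yl Ys ε) ΓD
        ε α β γ σ ΦD T c₀p c₀m v p Φ cp cm →
      (SNPP.VolumeAdditivity T cp cm →
        (SNPP.BoundedAboveBy T cp Λ ∧ SNPP.BoundedAboveBy T cm Λ) ∧
        (SNPP.BoundedAboveBy T cp 1 ∧ SNPP.BoundedAboveBy T cm 1)) ∧
      (ΓD = ∅ → σ = 0 →
        SNPP.BoundedAboveBy T cp Λ ∧ SNPP.BoundedAboveBy T cm Λ) := by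
  intro ε hε _ _ _ _ ΓD _ _ v p Φ cp cm h
  have pore_subset : SNPP.poreSpace Ω Yl ε ⊆ Ω := inter_subset_left
  have pore_open : IsOpen (SNPP.poreSpace Ω Yl ε) := hΩ.inter isOpen_interior
  exact mainTheorem12_general pore_open (hΩb.subset pore_subset).measure_lt_top.ne hε hT
    (ae_restrict_of_forall_mem pore_open.measurableSet fun x hx => hc₀p x (pore_subset hx))
    (ae_restrict_of_forall_mem pore_open.measurableSet fun x hx => hc₀m x (pore_subset hx)) h
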